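/- Let $N$ be a random variable with values in $\{0,1,2,\dots;\infty\}$ and generating function $H(s)=\mathbb E[s^N]$, $s\in[0,1]$ (with $s^\infty=0$ for $s<1$ and $1^\infty=1$), such that $H(0)=0$ and $H$ is strictly convex on $[0,1]$. For a probability measure $\nu$ on $[0,1]$ let $\mathcal T(\nu)$ be the law of $1-\prod_{i=1}^N X_i$, where the $X_i$ have law $\nu$ and $N,X_1,X_2,\dots$ are independent. Put $f(t)=1-H(t)$ and $f^{(2)}=f\circ f$. Let $\mu^1_+\in[0,1]$ be a fixed point of $f^{(2)}$, with partner $\mu^1_-=f(\mu^1_+)$. On the tree $\mathbf T=\bigcup_{n\ge0}\mathbb N^n$ let $(N_u)_{u\in\mathbf T}$ be i.i.d. copies of $N$ and let $(S^+_u)_{u\in\mathbf T}$ be the corresponding discrete solution: the $S^+_u$ take values in $\{0,1\}$, $S^+_u=1-\prod_{i=1}^{N_u}S^+_{ui}$ almost surely for every $u$, for every $n$ the variables $(S^+_u)_{|u|=n}$ are mutually independent and independent of $(N_v)_{|v|<n}$, and $\mathbb P(S^+_u=1)$ is $\mu^1_+$ if $|u|$ is even and $\mu^1_-$ if $|u|$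 is odd. Let $\varsigma_+$ be the law of $C^+=\mathbb P(S^+_\emptyset=1\mid N_v,\ v\in\mathbf T)$. Let $B(\varsigma_+)$ be the set of probability measures $\pi$ on $[0,1]$ such that $\mathcal T^{2n}(\pi)\to\varsigma_+$ weakly as $n\to\infty$, and let $b^2(\mu^1_+)$ be the set of $m\in[0,1]$ such that $(f^{(2)})^n(m)\to\mu^1_+$ as $n\to\infty$. **Theorem 6.3.** The following dichotomy holds. (i) If $0<\mu^1_+<1$ and $H'(\mu^1_+)H'(\mu^1_-)>1$, then $$B(\varsigma_+)=\{\pi:\ \pi\text{ has mean }\mu^1_+\text{ and }\pi(\{0,1\})\neq1\}.$$ (ii) Otherwise, i.e. if $\mu^1_+\in\{0,1\}$ or $H'(\mu^1_+)H'(\mu^1_-)\le1$, then $$B(\varsigma_+)=\{\pi:\ \pi\text{ has mean in }b^2(\mu^1_+)\}.$$ -/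

import Mathlib

open MeasureTheory ProbabilityTheory Filter Topology
open scoped unitInterval

namespace VetoVoter

noncomputable section

/-! ### The recursive distributional equation -/

/-- The product `∏_{i < n} x i` of the first `n` terms of a sequence in `[0,1]`, where
`n` may be infinite (the terms are numbered from `0`). -/
def liveProd (n : ℕ∞) (x : ℕ → I) : I :=
  ∏' i : ℕ, if (i : ℕ∞) < n then x i else 1

/-- Every product in `[0,1]` converges, so that `liveProd` never takes a default value. -/
theorem hasProd_liveProd (n : ℕ∞) (x : ℕ → I) :
    HasProd (fun i : ℕ => if (i : ℕ∞) < n then x i else 1) (liveProd n x) := by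
  refine Multipliable.hasProd ⟨_, tendsto_atTop_ciInf (fun s t hst => ?_) (OrderBot.bddBelow _)⟩
  rw [← Finset.prod_sdiff hst]
  exact unitInterval.mul_le_right

/-- The right-hand side of the equation `X = 1 - ∏_{i < N} X i`. -/
def rdeMap (p : ℕ∞ × (ℕ → I)) : I := unitInterval.symm (liveProd p.1 p.2)

theorem measurable_rdeMap : Measurable rdeMap := by
  have h : Measurable (fun p : ℕ∞ × (ℕ → I) => liveProd p.1 p.2) := by
    refine measurable_of_tendsto_metrizable
      (f := fun (k : ℕ) (p : ℕ∞ × (ℕ → I)) =>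
        ∏ i ∈ Finset.range k, if (i : ℕ∞) < p.1 then p.2 i else 1) (fun k => ?_) ?_
    · refine Finset.measurable_fun_prod _ fun i _ => Measurable.ite ?_ ?_ measurable_const
      · exact measurable_fst (MeasurableSet.of_discrete (s := {n : ℕ∞ | (i : ℕ∞) < n}))
      · exact (measurable_pi_apply i).comp measurable_snd
    · exact tendsto_pi_nhds.2 fun p => (hasProd_liveProd p.1 p.2).tendsto_prod_nat
  exact unitInterval.continuous_symm.measurable.comp h

/-- The map `𝒯` on laws on `[0,1]`: `𝒯 ν` is the law of `1 - ∏_{i < N} X i`, where `N` has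
law `d`, the `X i` have law `ν`, and all of these are independent. -/
def rdeLaw (d : ProbabilityMeasure ℕ∞) (ν : ProbabilityMeasure I) : ProbabilityMeasure I :=
  ⟨((d : Measure ℕ∞).prod (Measure.infinitePi fun _ : ℕ => (ν : Measure I))).map rdeMap,
    Measure.isProbabilityMeasure_map measurable_rdeMap.aemeasurable⟩

/-- The basin of attraction of `π` under `𝒯²`, for weak convergence of laws on `[0,1]`. -/
def lawBasin₂ (d : ProbabilityMeasure ℕ∞) (π : ProbabilityMeasure I) :
    Set (ProbabilityMeasure I) :=
  {ν | Tendsto (fun n : ℕ => (rdeLaw d ∘ rdeLaw d)^[n] ν) atTop (𝓝 π)}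

/-- The mean of a law on `[0,1]`. -/
def mean (ν : ProbabilityMeasure I) : ℝ := ∫ x : I, (x : ℝ) ∂(ν : Measure I)

/-! ### The generating function and the map for the first moment -/

/-- The power `s ^ n` with `n ∈ {0, 1, …; ∞}`, for `s ∈ [0,1]`: `s ^ ∞ = 0` if `s < 1`, and
`1 ^ ∞ = 1`. -/
def enatPow (s : ℝ) (n : ℕ∞) : ℝ :=
  if n = ⊤ then (if s = 1 then 1 else 0) else s ^ n.toNat

/-- The generating function `H s = 𝔼[s ^ N]`, on `[0,1]`. -/
def pgf (d : ProbabilityMeasure ℕ∞) (s : ℝ) : ℝ := ∫ n, enatPow s n ∂(d : Measure ℕ∞)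

/-- The map `f : t ↦ 1 - H t`. -/
def momentMap (d : ProbabilityMeasure ℕ∞) (t : ℝ) : ℝ := 1 - pgf d t

/-- The basin of attraction of `a` in `[0,1]` under `f ∘ f`. -/
def momentBasin₂ (d : ProbabilityMeasure ℕ∞) (a : ℝ) : Set ℝ :=
  {m | m ∈ Set.Icc (0 : ℝ) 1 ∧
    Tendsto (fun n : ℕ => (momentMap d ∘ momentMap d)^[n] m) atTop (𝓝 a)}

/-! ### Tree-indexed solutions -/

/-- A vertex of the tree with infinite branching. The root is `[]` and the daughters of `u` are
`i :: u` for `i = 0, 1, 2, …` (so an address is read from right to left); the depth of `u` is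
`u.length`. The live daughters of `u` are the `i :: u` with `i < N u`. -/
abbrev Vertex : Type := List ℕ

/-- `(S u)` is a tree-indexed discrete solution of the equation, driven by the independent
family sizes `(N u)` with law `d`, whose values are in `{0,1}` and have mean `a` at even
levels and mean `b` at odd levels. -/
structure IsInterleavedDiscreteSolution {Ω : Type*} [MeasurableSpace Ω] (P : Measure Ω)
    (d : ProbabilityMeasure ℕ∞) (a b : ℝ) (N : Vertex → Ω → ℕ∞) (S : Vertex → Ω → I) :
    Prop where
  measurable_N : ∀ u, Measurable (N u)
  law_N : ∀ u, P.map (N u) = (d : Measure ℕ∞)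
  indep_N : iIndepFun N P
  measurable_S : ∀ u, Measurable (S u)
  /-- The values at level `n` are mutually independent … -/
  indep_level : ∀ n : ℕ, iIndepFun (fun u : {u : Vertex // u.length = n} => S u) P
  /-- … and independent of the family sizes above level `n`. -/
  indep_noise : ∀ n : ℕ, IndepFun
    (fun ω => fun u : {u : Vertex // u.length = n} => S u ω)
    (fun ω => fun v : {v : Vertex // v.length < n} => N v ω) P
  recursion : ∀ u, ∀ᵐ ω ∂P, S u ω = rdeMap (N u ω, fun i => S (i :: u) ω)
  zero_or_one : ∀ u, ∀ᵐ ω ∂P, S u ω = 0 ∨ S u ω = 1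
  prob_one : ∀ u, P.real {ω | S u ω = 1} = if Even u.length then a else b

/-- The σ-algebra generated by all the family sizes. -/
abbrev noise {Ω : Type*} (N : Vertex → Ω → ℕ∞) : MeasurableSpace Ω :=
  ⨆ u, MeasurableSpace.comap (N u) inferInstance

/-- The conditional probability solution at the root, `C = ℙ(S_∅ = 1 | N_v, all v)`. The
projection onto `[0,1]` only changes it on a null set. -/
def condSol {Ω : Type*} [MeasurableSpace Ω] (P : Measure Ω) (N : Vertex → Ω → ℕ∞)
    (S : Vertex → Ω → I) (ω : Ω) : I :=
  Set.projIcc (0 : ℝ) 1 zero_le_one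
    (condExp (noise N) P ({ω | S [] ω = 1}.indicator fun _ => (1 : ℝ)) ω)

theorem measurable_condSol {Ω : Type*} [MeasurableSpace Ω] {P : Measure Ω}
    {N : Vertex → Ω → ℕ∞} (hN : ∀ u, Measurable (N u)) (S : Vertex → Ω → I) :
    Measurable (condSol P N S) := by
  have hle : noise N ≤ ‹MeasurableSpace Ω› := iSup_le fun u => (hN u).comap_le
  exact continuous_projIcc.measurable.comp
    (stronglyMeasurable_condExp.measurable.mono hle le_rfl)

/-- The law of the conditional probability solution at the root. -/
def condSolLaw {Ω : Type*} [MeasurableSpace Ω] (P : Measure Ω) [IsProbabilityMeasure P]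
    (N : Vertex → Ω → ℕ∞) (hN : ∀ u, Measurable (N u)) (S : Vertex → Ω → I) :
    ProbabilityMeasure I :=
  ⟨P.map (condSol P N S),
    Measure.isProbabilityMeasure_map (measurable_condSol hN S).aemeasurable⟩

end

end VetoVoter

namespace VetoVoter

noncomputable section

/-! ### Products of random variables -/

/-! The first two moments close up under the recursion. If `X` has mean `m` and `v = 𝔼[X (1 - X)]`,
then `(∏ X i)² = ∏ (X i)²` and independence show that one step sends `m` to `1 - H m` and `v` to
`gap H m v = H m - H (m - v)`. The quantity `v` (`bernoulliGap`) vanishes exactly for laws carried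
by `{0,1}`. Strict convexity of `H` makes `gap H m` strictly concave in `v`, with value `0` and
slope `H' m` at `v = 0`. Over two steps at the fixed point the slope at `0` is therefore `H' a * H'
b`, which decides the dichotomy.

If the slope is at most `1`, strict concavity forces `v → 0` whenever the means tend to `a`
(`IsGenFun.tendsto_gap_zero`); for `a ∈ {0,1}` the bound `v ≤ m - m²` suffices. Every such orbit of
laws converges to the law on `{0,1}` with mean `a`, so only the mean matters.

If `0 < a < 1` and the slope exceeds `1`, the two-step map has an attracting positive fixed point
`l`, and every positive `v` tends to it (`IsGenFun.exists_tendsto_gap`). To pass from moments to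
laws, `π` with mean `a` is coupled with the constant `a`, both evolving with the same family sizes.
Their mixed moment always equals the second moment of the constant's orbit, so their mean square
distance is a difference of two gaps, which tends to `l - l = 0`. Conversely, the mean of an
attracted law must be `a`, since `a` is a repelling fixed point of the injective map `f ∘ f`, and a
law on `{0,1}` keeps `v = 0` whereas the limit has `v = l`.

Finally, the law of the conditional probability solution is the limit of the even iterates of the
constant `a` (`tendsto_condSolLaw`): given the family sizes above level `2n`, independent leaves may
be replaced by their mean `a`, and Lévy's upward theorem lets `n → ∞`. -/

theorem tendsto_liveProd (n : ℕ∞) (x : ℕ → I) :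
    Tendsto (fun k : ℕ => ∏ i ∈ Finset.range k, ((if (i : ℕ∞) < n then x i else 1 : I) : ℝ))
      atTop (𝓝 (liveProd n x : ℝ)) := by
  have h := (continuous_subtype_val.tendsto _).comp (hasProd_liveProd n x).tendsto_prod_nat
  refine h.congr fun k => ?_
  simp only [Function.comp]
  exact map_prod unitInterval.submonoid.subtype _ _

theorem measurable_liveProd : Measurable (fun p : ℕ∞ × (ℕ → I) => liveProd p.1 p.2) := by
  have h : (fun p : ℕ∞ × (ℕ → I) => liveProd p.1 p.2) = fun p => unitInterval.symm (rdeMap p) := by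
    funext p; simp [rdeMap]
  rw [h]
  exact unitInterval.continuous_symm.measurable.comp measurable_rdeMap

theorem liveProd_mul (n : ℕ∞) (x y : ℕ → I) :
    (liveProd n (fun i => x i * y i) : ℝ) = liveProd n x * liveProd n y := by
  refine tendsto_nhds_unique (tendsto_liveProd n _)
    (((tendsto_liveProd n x).mul (tendsto_liveProd n y)).congr fun k => ?_)
  rw [← Finset.prod_mul_distrib]
  refine Finset.prod_congr rfl fun i _ => ?_
  split_ifs <;> simp

theorem liveProd_const (n : ℕ∞) (s : I) : (liveProd n (fun _ => s) : ℝ) = enatPow s n := by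
  have h := tendsto_liveProd n fun _ => s
  refine tendsto_nhds_unique h ?_
  rcases eq_or_ne n ⊤ with rfl | hn
  · have h1 : ∀ i : ℕ, (i : ℕ∞) < ⊤ := fun i => ENat.natCast_lt_top i
    simp only [h1, if_true, Finset.prod_const, Finset.card_range, enatPow]
    split_ifs with hs
    · simp [hs]
    · exact tendsto_pow_atTop_nhds_zero_of_lt_one s.2.1 (lt_of_le_of_ne s.2.2 hs)
  · lift n to ℕ using hn
    refine tendsto_const_nhds.congr' ?_
    filter_upwards [eventually_ge_atTop n] with k hk
    have : ∀ i : ℕ, ((if (i : ℕ∞) < (n : ℕ∞) then s else 1 : I) : ℝ)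
        = if i < n then (s : ℝ) else 1 := fun i => by
      simp only [Nat.cast_lt]; split_ifs <;> simp
    simp only [this, enatPow, ENat.natCast_ne_top, if_false, ENat.toNat_natCast]
    rw [Finset.prod_ite, Finset.prod_const_one, mul_one, Finset.prod_const]
    congr 1
    have : Finset.filter (fun i => i < n) (Finset.range k) = Finset.range n := by
      ext i; simp; omega
    rw [this, Finset.card_range]

theorem integrable_unitInterval {E : Type*} [MeasurableSpace E] (μ : Measure E)
    [IsProbabilityMeasure μ] {g : E → I} (hg : Measurable g) :
    Integrable (fun e => (g e : ℝ)) μ := by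
  refine Integrable.of_bound (C := 1) (measurable_subtype_coe.comp hg).aestronglyMeasurable ?_
  filter_upwards with e
  rw [Real.norm_eq_abs, abs_of_nonneg (g e).2.1]
  exact (g e).2.2

/-- The mean of a random variable with values in `[0,1]`, as an element of `[0,1]`. -/
def meanI {E : Type*} [MeasurableSpace E] (μ : Measure E) (g : E → I) : I :=
  Set.projIcc (0 : ℝ) 1 zero_le_one (∫ e, (g e : ℝ) ∂μ)

theorem integral_mem_unitInterval {E : Type*} [MeasurableSpace E] (μ : Measure E)
    [IsProbabilityMeasure μ] {g : E → I} (hg : Measurable g) :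
    (∫ e, (g e : ℝ) ∂μ) ∈ Set.Icc (0 : ℝ) 1 := by
  refine ⟨integral_nonneg fun e => (g e).2.1, ?_⟩
  calc (∫ e, (g e : ℝ) ∂μ) ≤ ∫ _, (1 : ℝ) ∂μ :=
        integral_mono (integrable_unitInterval μ hg) (integrable_const _) fun e => (g e).2.2
    _ = 1 := by simp

theorem coe_meanI {E : Type*} [MeasurableSpace E] (μ : Measure E)
    [IsProbabilityMeasure μ] {g : E → I} (hg : Measurable g) :
    (meanI μ g : ℝ) = ∫ e, (g e : ℝ) ∂μ := by
  rw [meanI, Set.projIcc_of_mem _ (integral_mem_unitInterval μ hg)]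

/-- Finite products factor by independence; the partial products lie in `[0,1]`, so bounded
convergence covers infinite families too. -/
theorem integral_liveProd {E : Type*} [MeasurableSpace E] (μ : Measure E)
    [IsProbabilityMeasure μ] {Y : ℕ → E → I} (hY : ∀ i, Measurable (Y i)) (hind : iIndepFun Y μ)
    (n : ℕ∞) :
    ∫ e, (liveProd n (fun i => Y i e) : ℝ) ∂μ = liveProd n (fun i => meanI μ (Y i)) := by
  set Z : ℕ → E → ℝ := fun i e => ((if (i : ℕ∞) < n then Y i e else 1 : I) : ℝ) with hZ
  have hmZ : ∀ i, Measurable (Z i) := fun i => by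
    by_cases h : (i : ℕ∞) < n
    · simpa [hZ, h] using (hY i).subtype_val
    · simp [hZ, h]
  have hindZ : iIndepFun Z μ := by
    have := hind.comp (fun i (y : I) => ((if (i : ℕ∞) < n then y else 1 : I) : ℝ)) fun i => by
      by_cases h : (i : ℕ∞) < n
      · simpa [h] using measurable_subtype_coe
      · simp [h]
    exact this
  have h1 : Tendsto (fun k : ℕ => ∫ e, ∏ i ∈ Finset.range k, Z i e ∂μ) atTop
      (𝓝 (∫ e, (liveProd n (fun i => Y i e) : ℝ) ∂μ)) := by
    refine tendsto_integral_of_dominated_convergence (fun _ => 1) (fun k => ?_)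
      (integrable_const _) (fun k => ?_) ?_
    · exact (Finset.measurable_fun_prod _ fun i _ => hmZ i).aestronglyMeasurable
    · filter_upwards with e
      rw [Real.norm_eq_abs, Finset.abs_prod]
      refine Finset.prod_le_one (fun i _ => abs_nonneg _) fun i _ => ?_
      rw [abs_of_nonneg (unitInterval.nonneg _)]
      exact unitInterval.le_one _
    · filter_upwards with e
      exact tendsto_liveProd n fun i => Y i e
  refine tendsto_nhds_unique h1 ((tendsto_liveProd n _).congr fun k => ?_)
  have h2 : iIndepFun (fun i : Fin k => Z i) μ := hindZ.precomp Fin.val_injective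
  have h3 := h2.integral_fun_prod_eq_prod_integral
    fun i => (hmZ i).aestronglyMeasurable
  simp only [Finset.prod_range]
  rw [h3]
  refine Finset.prod_congr rfl fun i _ => ?_
  by_cases h : ((i : ℕ) : ℕ∞) < n
  · simp [hZ, h, coe_meanI μ (hY _)]
  · simp [hZ, h]

theorem integral_sub_sub_add {E : Type*} [MeasurableSpace E] {μ : Measure E} {f g h k : E → ℝ}
    (hf : Integrable f μ) (hg : Integrable g μ) (hh : Integrable h μ) (hk : Integrable k μ) :
    ∫ e, (f e - g e - h e + k e) ∂μ
      = ∫ e, f e ∂μ - ∫ e, g e ∂μ - ∫ e, h e ∂μ + ∫ e, k e ∂μ := by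
  have h1 : Integrable (fun e => f e - g e) μ := hf.sub hg
  have h2 : Integrable (fun e => f e - g e - h e) μ := h1.sub hh
  rw [integral_add h2 hk, integral_sub h1 hh, integral_sub hf hg]

/-! ### One step of the recursion with general marks -/

section Node

variable {E : Type*} [MeasurableSpace E]

/-- The law of the noise at a vertex, together with independent marks of law `γ`. -/
abbrev nodeLaw (d : ProbabilityMeasure ℕ∞) (γ : Measure E) : Measure (ℕ∞ × (ℕ → E)) :=
  (d : Measure ℕ∞).prod (Measure.infinitePi fun _ : ℕ => γ)

/-- One step of the recursion, in terms of marks that are read by `g`. -/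
abbrev nodeMap (g : E → I) (p : ℕ∞ × (ℕ → E)) : I := rdeMap (p.1, fun i => g (p.2 i))

theorem measurable_nodeMap {g : E → I} (hg : Measurable g) : Measurable (nodeMap g) :=
  measurable_rdeMap.comp (by fun_prop)

theorem integral_liveProd_nodeLaw (d : ProbabilityMeasure ℕ∞) (γ : Measure E)
    [IsProbabilityMeasure γ] {g : E → I} (hg : Measurable g) :
    ∫ p, (liveProd p.1 (fun i => g (p.2 i)) : ℝ) ∂(nodeLaw d γ) = pgf d (∫ e, (g e : ℝ) ∂γ) := by
  have hm : Measurable (fun p : ℕ∞ × (ℕ → E) => liveProd p.1 (fun i => g (p.2 i))) :=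
    measurable_liveProd.comp (f := fun p : ℕ∞ × (ℕ → E) => (p.1, fun i => g (p.2 i)))
      (by fun_prop)
  rw [integral_prod _ (integrable_unitInterval _ hm), pgf]
  refine integral_congr_ae (Eventually.of_forall fun n => ?_)
  have hind : iIndepFun (fun (i : ℕ) (x : ℕ → E) => g (x i)) (Measure.infinitePi fun _ : ℕ => γ) :=
    iIndepFun_infinitePi fun _ => hg
  have h := integral_liveProd (Measure.infinitePi fun _ : ℕ => γ)
    (fun i => hg.comp (measurable_pi_apply i)) hind n
  refine h.trans ?_
  have h2 : ∀ i, meanI (Measure.infinitePi fun _ : ℕ => γ) (fun x : ℕ → E => g (x i)) = meanI γ g :=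
    fun i => by
      have h3 := integral_map (μ := Measure.infinitePi fun _ : ℕ => γ)
        (φ := fun x : ℕ → E => x i) (measurable_pi_apply i).aemeasurable (f := fun e => (g e : ℝ))
        (by exact hg.subtype_val.aestronglyMeasurable)
      rw [Measure.infinitePi_map_eval] at h3
      rw [meanI, meanI, h3]
  simp only [Function.comp_def, h2]
  rw [liveProd_const, coe_meanI γ hg]

omit [MeasurableSpace E] in
theorem coe_nodeMap (g : E → I) (p : ℕ∞ × (ℕ → E)) :
    (nodeMap g p : ℝ) = 1 - liveProd p.1 (fun i => g (p.2 i)) := rfl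

theorem measurable_liveProd_comp {g : E → I} (hg : Measurable g) :
    Measurable (fun p : ℕ∞ × (ℕ → E) => liveProd p.1 (fun i => g (p.2 i))) :=
  measurable_liveProd.comp (f := fun p : ℕ∞ × (ℕ → E) => (p.1, fun i => g (p.2 i)))
    (by fun_prop)

theorem integral_nodeMap (d : ProbabilityMeasure ℕ∞) (γ : Measure E)
    [IsProbabilityMeasure γ] {g : E → I} (hg : Measurable g) :
    ∫ p, (nodeMap g p : ℝ) ∂(nodeLaw d γ) = 1 - pgf d (∫ e, (g e : ℝ) ∂γ) := by
  simp only [coe_nodeMap]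
  rw [integral_sub (integrable_const _) (integrable_unitInterval _ (measurable_liveProd_comp hg)),
    integral_liveProd_nodeLaw d γ hg]
  simp

/-- In `(1 - ∏ g) (1 - ∏ h)` the cross term is `∏ (g h)`, again a product over one family, so its
mean is another value of `H`. Two readings `g`, `h` of the same marks cover both second moments and
couplings. -/
theorem integral_nodeMap_mul (d : ProbabilityMeasure ℕ∞) (γ : Measure E)
    [IsProbabilityMeasure γ] {g h : E → I} (hg : Measurable g) (hh : Measurable h) :
    ∫ p, (nodeMap g p : ℝ) * nodeMap h p ∂(nodeLaw d γ) =
      1 - pgf d (∫ e, (g e : ℝ) ∂γ) - pgf d (∫ e, (h e : ℝ) ∂γ)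
        + pgf d (∫ e, (g e : ℝ) * h e ∂γ) := by
  have hgh : Measurable fun e => g e * h e := hg.mul hh
  have e1 : ∀ p : ℕ∞ × (ℕ → E), (nodeMap g p : ℝ) * nodeMap h p =
      1 - liveProd p.1 (fun i => g (p.2 i)) - liveProd p.1 (fun i => h (p.2 i))
        + liveProd p.1 (fun i => g (p.2 i) * h (p.2 i)) := fun p => by
    rw [coe_nodeMap, coe_nodeMap, liveProd_mul]; ring
  simp only [e1]
  have i1 := integrable_unitInterval (nodeLaw d γ) (measurable_liveProd_comp hg)
  have i2 := integrable_unitInterval (nodeLaw d γ) (measurable_liveProd_comp hh)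
  have i3 := integrable_unitInterval (nodeLaw d γ) (measurable_liveProd_comp hgh)
  have i0 : Integrable (fun _ : ℕ∞ × (ℕ → E) => (1 : ℝ)) (nodeLaw d γ) := integrable_const _
  rw [integral_sub_sub_add i0 i1 i2 i3,
    integral_liveProd_nodeLaw d γ hg, integral_liveProd_nodeLaw d γ hh,
    integral_liveProd_nodeLaw d γ hgh]
  simp

theorem map_nodeMap (d : ProbabilityMeasure ℕ∞) (γ : Measure E)
    [IsProbabilityMeasure γ] {g : E → I} (hg : Measurable g) (ν : ProbabilityMeasure I)
    (hν : γ.map g = ν) :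
    (nodeLaw d γ).map (nodeMap g) = (rdeLaw d ν : Measure I) := by
  have h1 : (Measure.infinitePi fun _ : ℕ => γ).map (fun x i => g (x i))
      = Measure.infinitePi fun _ : ℕ => (ν : Measure I) := by
    rw [Measure.infinitePi_map_pi (f := fun _ : ℕ => g) _ fun _ => hg]
    simp only [hν]
  have h2 : (nodeLaw d γ).map (Prod.map id fun x i => g (x i))
      = (d : Measure ℕ∞).prod (Measure.infinitePi fun _ : ℕ => (ν : Measure I)) := by
    rw [nodeLaw, ← Measure.map_prod_map _ _ measurable_id (by fun_prop), h1, Measure.map_id]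
  change _ = ((d : Measure ℕ∞).prod (Measure.infinitePi fun _ : ℕ => (ν : Measure I))).map rdeMap
  rw [← h2, Measure.map_map measurable_rdeMap (by fun_prop)]
  rfl

end Node

/-! ### First and second moments under the recursion -/

/-- The second moment of a law on `[0,1]`. -/
def secondMoment (ν : ProbabilityMeasure I) : ℝ := ∫ x : I, (x : ℝ) * x ∂(ν : Measure I)

theorem map_nodeMap_id (d : ProbabilityMeasure ℕ∞) (ν : ProbabilityMeasure I) :
    (nodeLaw d (ν : Measure I)).map (nodeMap id) = (rdeLaw d ν : Measure I) :=
  map_nodeMap d _ measurable_id ν Measure.map_id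

theorem mean_rdeLaw (d : ProbabilityMeasure ℕ∞) (ν : ProbabilityMeasure I) :
    mean (rdeLaw d ν) = momentMap d (mean ν) := by
  rw [mean, ← map_nodeMap_id, integral_map (measurable_nodeMap measurable_id).aemeasurable
    measurable_subtype_coe.aestronglyMeasurable, integral_nodeMap d _ measurable_id]
  rfl

theorem secondMoment_rdeLaw (d : ProbabilityMeasure ℕ∞) (ν : ProbabilityMeasure I) :
    secondMoment (rdeLaw d ν) = 1 - 2 * pgf d (mean ν) + pgf d (secondMoment ν) := by
  rw [secondMoment, ← map_nodeMap_id, integral_map (measurable_nodeMap measurable_id).aemeasurable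
    (by exact (measurable_subtype_coe.mul measurable_subtype_coe).aestronglyMeasurable),
    integral_nodeMap_mul d _ measurable_id measurable_id]
  simp only [mean, secondMoment, id]
  ring

theorem mean_mem (ν : ProbabilityMeasure I) : mean ν ∈ Set.Icc (0 : ℝ) 1 :=
  integral_mem_unitInterval _ measurable_id

theorem integrable_coe (ν : ProbabilityMeasure I) :
    Integrable (fun x : I => (x : ℝ)) (ν : Measure I) :=
  integrable_unitInterval _ measurable_id

theorem integrable_coe_mul (ν : ProbabilityMeasure I) :
    Integrable (fun x : I => (x : ℝ) * x) (ν : Measure I) := by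
  have h := integrable_unitInterval (ν : Measure I) (g := fun x : I => x * x)
    (measurable_id.mul measurable_id)
  simpa using h

theorem secondMoment_nonneg (ν : ProbabilityMeasure I) : 0 ≤ secondMoment ν :=
  integral_nonneg fun x => mul_self_nonneg (x : ℝ)

theorem secondMoment_le_mean (ν : ProbabilityMeasure I) : secondMoment ν ≤ mean ν :=
  integral_mono (integrable_coe_mul ν) (integrable_coe ν)
    fun x => mul_le_of_le_one_left x.2.1 x.2.2

theorem sq_mean_le_secondMoment (ν : ProbabilityMeasure I) : mean ν ^ 2 ≤ secondMoment ν := by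
  have h : 0 ≤ ∫ x : I, ((x : ℝ) - mean ν) * (x - mean ν) ∂(ν : Measure I) :=
    integral_nonneg fun x => mul_self_nonneg _
  have e : ∀ x : I, ((x : ℝ) - mean ν) * (x - mean ν) =
      x * x - mean ν * x - mean ν * x + mean ν ^ 2 := fun x => by ring
  simp only [e] at h
  have i1 := (integrable_coe ν).const_mul (mean ν)
  rw [integral_sub_sub_add (integrable_coe_mul ν) i1 i1 (integrable_const _),
    integral_const_mul] at h
  simp only [integral_const, probReal_univ, smul_eq_mul, one_mul] at h
  change 0 ≤ secondMoment ν - mean ν * mean ν - mean ν * mean ν + mean ν ^ 2 at h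
  nlinarith

theorem mean_sub_secondMoment (ν : ProbabilityMeasure I) :
    ∫ x : I, (x : ℝ) * (1 - x) ∂(ν : Measure I) = mean ν - secondMoment ν := by
  rw [mean, secondMoment, ← integral_sub (integrable_coe ν) (integrable_coe_mul ν)]
  exact integral_congr_ae (Eventually.of_forall fun x => by ring)

/-! ### Coupling -/

/-- The recursion applied to two coupled laws, with the same family size. -/
def coupledLaw (d : ProbabilityMeasure ℕ∞) (γ : ProbabilityMeasure (I × I)) :
    ProbabilityMeasure (I × I) :=
  ⟨(nodeLaw d (γ : Measure (I × I))).map (fun p => (nodeMap Prod.fst p, nodeMap Prod.snd p)),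
    Measure.isProbabilityMeasure_map ((measurable_nodeMap measurable_fst).prodMk
      (measurable_nodeMap measurable_snd)).aemeasurable⟩

theorem map_fst_coupledLaw (d : ProbabilityMeasure ℕ∞) (γ : ProbabilityMeasure (I × I))
    (ν : ProbabilityMeasure I) (h : (γ : Measure (I × I)).map Prod.fst = ν) :
    (coupledLaw d γ : Measure (I × I)).map Prod.fst = rdeLaw d ν := by
  rw [← map_nodeMap d (γ : Measure (I × I)) measurable_fst ν h]
  exact Measure.map_map measurable_fst ((measurable_nodeMap measurable_fst).prodMk
      (measurable_nodeMap measurable_snd))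

theorem map_snd_coupledLaw (d : ProbabilityMeasure ℕ∞) (γ : ProbabilityMeasure (I × I))
    (ν : ProbabilityMeasure I) (h : (γ : Measure (I × I)).map Prod.snd = ν) :
    (coupledLaw d γ : Measure (I × I)).map Prod.snd = rdeLaw d ν := by
  rw [← map_nodeMap d (γ : Measure (I × I)) measurable_snd ν h]
  exact Measure.map_map measurable_snd ((measurable_nodeMap measurable_fst).prodMk
      (measurable_nodeMap measurable_snd))

/-- The mixed moment of a law on `[0,1]²`. -/
def mixedMoment (γ : ProbabilityMeasure (I × I)) : ℝ :=
  ∫ p : I × I, (p.1 : ℝ) * p.2 ∂(γ : Measure (I × I))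

theorem mixedMoment_coupledLaw (d : ProbabilityMeasure ℕ∞) (γ : ProbabilityMeasure (I × I))
    (ν ν' : ProbabilityMeasure I) (h : (γ : Measure (I × I)).map Prod.fst = ν)
    (h' : (γ : Measure (I × I)).map Prod.snd = ν') :
    mixedMoment (coupledLaw d γ) =
      1 - pgf d (mean ν) - pgf d (mean ν') + pgf d (mixedMoment γ) := by
  rw [mixedMoment, coupledLaw, ProbabilityMeasure.coe_mk,
    integral_map ((measurable_nodeMap measurable_fst).prodMk
      (measurable_nodeMap measurable_snd)).aemeasurable
      (by exact ((measurable_subtype_coe.comp measurable_fst).mul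
        (measurable_subtype_coe.comp measurable_snd)).aestronglyMeasurable),
    integral_nodeMap_mul d _ measurable_fst measurable_snd]
  simp only [mean, mixedMoment, ← h, ← h']
  rw [integral_map measurable_fst.aemeasurable measurable_subtype_coe.aestronglyMeasurable,
    integral_map measurable_snd.aemeasurable measurable_subtype_coe.aestronglyMeasurable]

theorem integral_sq_sub (γ : ProbabilityMeasure (I × I))
    (ν ν' : ProbabilityMeasure I) (h : (γ : Measure (I × I)).map Prod.fst = ν)
    (h' : (γ : Measure (I × I)).map Prod.snd = ν') :
    ∫ p : I × I, ((p.1 : ℝ) - p.2) ^ 2 ∂(γ : Measure (I × I)) =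
      secondMoment ν - 2 * mixedMoment γ + secondMoment ν' := by
  have m1 : Measurable fun p : I × I => p.1 * p.1 := measurable_fst.mul measurable_fst
  have m2 : Measurable fun p : I × I => p.1 * p.2 := measurable_fst.mul measurable_snd
  have m3 : Measurable fun p : I × I => p.2 * p.2 := measurable_snd.mul measurable_snd
  have i1 := integrable_unitInterval (γ : Measure (I × I)) m1
  have i2 := integrable_unitInterval (γ : Measure (I × I)) m2
  have i3 := integrable_unitInterval (γ : Measure (I × I)) m3
  have e : ∀ p : I × I, ((p.1 : ℝ) - p.2) ^ 2 =
      ((p.1 * p.1 : I) : ℝ) - ((p.1 * p.2 : I) : ℝ) - ((p.1 * p.2 : I) : ℝ)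
        + ((p.2 * p.2 : I) : ℝ) := fun p => by
    push_cast; ring
  simp only [e]
  rw [integral_sub_sub_add i1 i2 i2 i3]
  simp only [secondMoment, mixedMoment, ← h, ← h']
  rw [integral_map measurable_fst.aemeasurable
      (by exact (measurable_subtype_coe.mul measurable_subtype_coe).aestronglyMeasurable),
    integral_map measurable_snd.aemeasurable
      (by exact (measurable_subtype_coe.mul measurable_subtype_coe).aestronglyMeasurable)]
  simp only [Set.Icc.coe_mul]
  ring

/-! ### Iteration of real functions -/

/-- The properties of a generating function that the analysis of moments uses. -/
structure IsGenFun (H : ℝ → ℝ) : Prop where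
  zero : H 0 = 0
  one : H 1 = 1
  nonneg : ∀ s ∈ Set.Icc (0 : ℝ) 1, 0 ≤ H s
  convex : StrictConvexOn ℝ (Set.Icc (0 : ℝ) 1) H
  diff : ∀ s ∈ Set.Ioo (0 : ℝ) 1, DifferentiableAt ℝ H s

/-- The increment of `H` over `[m - v, m]`. -/
def gap (H : ℝ → ℝ) (m v : ℝ) : ℝ := H m - H (m - v)

/-! ### Monotonicity and convexity estimates for `gap` -/

namespace IsGenFun

variable {H : ℝ → ℝ} (hH : IsGenFun H)
include hH

theorem mul_lt {x t : ℝ} (hx : 0 < x) (hx1 : x ≤ 1) (ht : 0 < t) (ht1 : t < 1) :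
    H (t * x) < t * H x := by
  have h := hH.convex.2 (show (0 : ℝ) ∈ Set.Icc (0 : ℝ) 1 by simp) ⟨hx.le, hx1⟩ hx.ne
    (show 0 < 1 - t by linarith) ht (by ring)
  simpa [hH.zero] using h

theorem pos {x : ℝ} (hx : 0 < x) (hx1 : x ≤ 1) : 0 < H x := by
  have h := hH.mul_lt hx hx1 (t := 1 / 2) (by norm_num) (by norm_num)
  have h2 := hH.nonneg (1 / 2 * x) ⟨by linarith, by linarith⟩
  linarith

/-- Chords from the origin suffice: `H x < (x / y) * H y < H y`. -/
theorem strictMonoOn : StrictMonoOn H (Set.Icc (0 : ℝ) 1) := by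
  intro x hx y hy hxy
  have hy0 : 0 < y := lt_of_le_of_lt hx.1 hxy
  rcases hx.1.eq_or_lt with h | h
  · rw [← h, hH.zero]; exact hH.pos hy0 hy.2
  · have h1 := hH.mul_lt hy0 hy.2 (t := x / y) (by positivity) ((div_lt_one hy0).2 hxy)
    rw [div_mul_cancel₀ _ hy0.ne'] at h1
    have h2 : x / y * H y < 1 * H y :=
      mul_lt_mul_of_pos_right ((div_lt_one hy0).2 hxy) (hH.pos hy0 hy.2)
    linarith

theorem mem {x : ℝ} (hx : x ∈ Set.Icc (0 : ℝ) 1) : H x ∈ Set.Icc (0 : ℝ) 1 :=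
  ⟨hH.nonneg x hx, hH.one ▸ hH.strictMonoOn.monotoneOn hx (by simp) hx.2⟩

theorem one_sub_mem {x : ℝ} (hx : x ∈ Set.Icc (0 : ℝ) 1) : 1 - H x ∈ Set.Icc (0 : ℝ) 1 :=
  ⟨by linarith [(hH.mem hx).2], by linarith [(hH.mem hx).1]⟩

theorem one_sub_mem_Ioo {x : ℝ} (hx : x ∈ Set.Ioo (0 : ℝ) 1) : 1 - H x ∈ Set.Ioo (0 : ℝ) 1 := by
  have h1 := hH.strictMonoOn ⟨hx.1.le, hx.2.le⟩ (b := 1) (by simp) hx.2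
  have h2 := hH.pos hx.1 hx.2.le
  rw [hH.one] at h1
  exact ⟨by linarith, by linarith⟩

theorem gap_mono {m v w : ℝ} (hm : m ≤ 1) (hv : 0 ≤ v) (hvw : v ≤ w) (hw : w ≤ m) :
    gap H m v ≤ gap H m w := by
  have := hH.strictMonoOn.monotoneOn (a := m - w) (b := m - v) ⟨by linarith, by linarith⟩
    ⟨by linarith, by linarith⟩ (by linarith)
  unfold gap; linarith

theorem gap_pos {m v : ℝ} (hm : m ≤ 1) (hv : 0 < v) (hw : v ≤ m) : 0 < gap H m v := by
  have := hH.strictMonoOn (a := m - v) (b := m) ⟨by linarith, by linarith⟩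
    ⟨by linarith, by linarith⟩ (by linarith)
  unfold gap; linarith

theorem gap_lt {m v A : ℝ} (hm : m ≤ 1) (hv : 0 < v) (hw : v ≤ m) (hA : HasDerivAt H A m) :
    gap H m v < A * v := by
  have h := hH.convex.slope_lt_of_hasDerivAt (x := m - v) (y := m) ⟨by linarith, by linarith⟩
    ⟨by linarith, by linarith⟩ (by linarith) hA
  rw [slope_def_field, div_lt_iff₀ (by linarith)] at h
  unfold gap
  calc H m - H (m - v) < A * (m - (m - v)) := h
    _ = A * v := by ring

/-- Strict concavity of `gap H m`, on the chord from `0`, where it vanishes. -/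
theorem mul_gap_lt {m v t : ℝ} (hm : m ≤ 1) (hv : 0 < v) (hw : v ≤ m) (ht : 0 < t)
    (ht1 : t < 1) : t * gap H m v < gap H m (t * v) := by
  have h := hH.convex.2 (show m ∈ Set.Icc (0 : ℝ) 1 from ⟨by linarith, hm⟩)
    (show m - v ∈ Set.Icc (0 : ℝ) 1 from ⟨by linarith, by linarith⟩) (by linarith)
    (show 0 < 1 - t by linarith) ht (by ring)
  simp only [smul_eq_mul] at h
  rw [show (1 - t) * m + t * (m - v) = m - t * v by ring] at h
  unfold gap
  linarith

/-- Strict subhomogeneity survives composition because the outer gap is monotone. Both long-term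
results rest on this inequality. -/
theorem mul_gap_gap_lt {m m' v t : ℝ} (hm : m ≤ 1) (hm' : m' ≤ 1) (hv : 0 < v) (hw : v ≤ m)
    (hg : gap H m v ≤ m') (ht : 0 < t) (ht1 : t < 1) :
    t * gap H m' (gap H m v) < gap H m' (gap H m (t * v)) := by
  have h1 := hH.gap_pos hm hv hw
  have h2 := hH.mul_gap_lt hm hv hw ht ht1
  have h3 : gap H m (t * v) ≤ gap H m v :=
    hH.gap_mono hm (by positivity) (by nlinarith) hw
  calc t * gap H m' (gap H m v) < gap H m' (t * gap H m v) :=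
        hH.mul_gap_lt hm' h1 hg ht ht1
    _ ≤ gap H m' (gap H m (t * v)) :=
        hH.gap_mono hm' (by positivity) h2.le (h3.trans hg)

theorem continuousAt {s : ℝ} (hs : s ∈ Set.Ioo (0 : ℝ) 1) : ContinuousAt H s :=
  (hH.diff s hs).continuousAt

/-- The strict bounds keep `a` and `a - w` inside `(0,1)`; at `1` a generating function jumps if `N`
can be infinite. -/
theorem tendsto_gap {ι : Type*} {l : Filter ι} {m v : ι → ℝ} {a w : ℝ}
    (hm : Tendsto m l (𝓝 a)) (hv : Tendsto v l (𝓝 w)) (ha : a < 1) (hw : 0 ≤ w) (hwa : w < a) :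
    Tendsto (fun i => gap H (m i) (v i)) l (𝓝 (gap H a w)) :=
  ((hH.continuousAt ⟨by linarith, ha⟩).tendsto.comp hm).sub
    ((hH.continuousAt ⟨by linarith, by linarith⟩).tendsto.comp (hm.sub hv))

end IsGenFun

/-- Above `ε` the sequence decays geometrically, and once below `ε` it stays there. The rate `c` may
depend on `ε`, which allows a linearization of slope exactly `1`. -/
theorem tendsto_zero_of_le_mul_max {v : ℕ → ℝ} (h0 : ∀ n, 0 ≤ v n) {δ : ℝ} (hδ : 0 < δ)
    (h : ∀ ε, 0 < ε → ε < δ → ∃ c, 0 ≤ c ∧ c < 1 ∧ ∀ᶠ n in atTop, v (n + 1) ≤ c * max (v n) ε) :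
    Tendsto v atTop (𝓝 0) := by
  rw [Metric.tendsto_atTop]
  intro e he
  obtain ⟨ε, hε, hεm⟩ := exists_between (lt_min he hδ)
  obtain ⟨c, hc0, hc1, hc⟩ := h ε hε (hεm.trans_le (min_le_right _ _))
  obtain ⟨n₀, hn₀⟩ := eventually_atTop.1 hc
  have h1 : ∀ k, v (n₀ + k) ≤ max (c ^ k * v n₀) ε := by
    intro k
    induction k with
    | zero => simp
    | succ k ih =>
      have h2 := hn₀ (n₀ + k) (by omega)
      rw [show n₀ + (k + 1) = n₀ + k + 1 by ring]
      refine h2.trans ?_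
      have h3 : max (v (n₀ + k)) ε ≤ max (c ^ k * v n₀) ε := max_le ih (le_max_right _ _)
      refine (mul_le_mul_of_nonneg_left h3 hc0).trans ?_
      rw [mul_max_of_nonneg _ _ hc0, pow_succ']
      refine max_le_max (by rw [mul_assoc]) (by nlinarith)
  have h2 : Tendsto (fun k => c ^ k * v n₀) atTop (𝓝 0) := by
    simpa using (tendsto_pow_atTop_nhds_zero_of_lt_one hc0 hc1).mul_const (v n₀)
  obtain ⟨K, hK⟩ := eventually_atTop.1 (h2.eventually (gt_mem_nhds hε))
  refine ⟨n₀ + K, fun n hn => ?_⟩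
  obtain ⟨k, rfl⟩ := Nat.exists_eq_add_of_le hn
  have h3 := h1 (K + k)
  rw [← add_assoc] at h3
  rw [Real.dist_eq, sub_zero, abs_of_nonneg (h0 _)]
  refine h3.trans_lt (max_lt ((hK (K + k) (by omega)).trans ?_) ?_) <;>
  exact hεm.trans_le (min_le_left _ _)

/-- A fixed point that is linearly unstable attracts only the orbits that hit it. -/
theorem exists_eq_of_tendsto_of_one_lt_deriv {F : ℝ → ℝ} {a c : ℝ} (hF : HasDerivAt F c a)
    (hc : 1 < c) (hFa : F a = a) {x : ℕ → ℝ} (hx : ∀ n, x (n + 1) = F (x n))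
    (hlim : Tendsto x atTop (𝓝 a)) : ∃ n, x n = a := by
  by_contra! hne
  have h1 : Tendsto x atTop (𝓝[≠] a) :=
    tendsto_nhdsWithin_iff.2 ⟨hlim, Eventually.of_forall hne⟩
  have h2 := ((hasDerivAt_iff_tendsto_slope.1 hF).comp h1).eventually (lt_mem_nhds hc)
  obtain ⟨n₀, hn₀⟩ := eventually_atTop.1 h2
  -- Near `a` the difference quotient exceeds `1`, so an orbit that avoids `a` cannot get closer to
  -- it.
  have h3 : ∀ n, n₀ ≤ n → |x n - a| ≤ |x (n + 1) - a| := fun n hn => by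
    have h4 := hn₀ n hn
    simp only [Function.comp, slope_def_field, hFa, ← hx] at h4
    have h5 : 0 < |x n - a| := abs_pos.2 (sub_ne_zero.2 (hne n))
    have h6 : 1 ≤ |(x (n + 1) - a) / (x n - a)| := h4.le.trans (le_abs_self _)
    rwa [abs_div, le_div_iff₀ h5, one_mul] at h6
  have h4 : ∀ k, |x n₀ - a| ≤ |x (n₀ + k) - a| := fun k => by
    induction k with
    | zero => rfl
    | succ k ih => exact ih.trans (h3 _ (by omega))
  have h5 : Tendsto (fun k => |x (n₀ + k) - a|) atTop (𝓝 0) := by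
    have : Tendsto (fun k => x (n₀ + k)) atTop (𝓝 a) :=
      hlim.comp (tendsto_atTop_mono (fun k => Nat.le_add_left k n₀) tendsto_id)
    simpa using (this.sub_const a).abs
  have h6 := ge_of_tendsto' h5 h4
  exact (abs_pos.2 (sub_ne_zero.2 (hne n₀))).not_ge h6

/-! ### Long-term behaviour of the two-step gap map -/

namespace IsGenFun

variable {H : ℝ → ℝ} (hH : IsGenFun H)
include hH

/-- If the linearization at `a` is not expanding, then the variances converge to `0`. -/
theorem tendsto_gap_zero {a A B : ℝ} (ha : a ∈ Set.Ioo (0 : ℝ) 1) (hA : HasDerivAt H A a)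
    (hB : HasDerivAt H B (1 - H a)) (hAB : A * B ≤ 1) {m v u : ℕ → ℝ}
    (hm : ∀ n, m n ∈ Set.Icc (0 : ℝ) 1) (hma : Tendsto m atTop (𝓝 a))
    (hv : ∀ n, 0 ≤ v n) (hvm : ∀ n, v n ≤ m n) (hu : ∀ n, u n = gap H (m n) (v n))
    (hum : ∀ n, u n ≤ 1 - H (m n)) (hv' : ∀ n, v (n + 1) = gap H (1 - H (m n)) (u n)) :
    Tendsto v atTop (𝓝 0) := by
  have hb := hH.one_sub_mem_Ioo ha
  set b := 1 - H a with hbdef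
  have hmb : Tendsto (fun n => 1 - H (m n)) atTop (𝓝 b) :=
    ((hH.continuousAt ha).tendsto.comp hma).const_sub 1
  have hA0 : 0 < A := by
    have := (hH.gap_pos ha.2.le ha.1 le_rfl).trans (hH.gap_lt ha.2.le ha.1 le_rfl hA)
    exact pos_of_mul_pos_left this ha.1.le
  have hB0 : 0 < B := by
    have := (hH.gap_pos hb.2.le hb.1 le_rfl).trans (hH.gap_lt hb.2.le hb.1 le_rfl hB)
    exact pos_of_mul_pos_left this hb.1.le
  -- The bound `ε < b / A` gives `gap H a ε < A * ε < b`, so both gaps stay where `H` is continuous.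
  refine tendsto_zero_of_le_mul_max hv (δ := min a (b / A))
    (lt_min ha.1 (div_pos hb.1 hA0)) fun ε hε hεδ => ?_
  have hεa : ε < a := hεδ.trans_le (min_le_left _ _)
  have hga : gap H a ε < A * ε := hH.gap_lt ha.2.le hε hεa.le hA
  have hga0 : 0 < gap H a ε := hH.gap_pos ha.2.le hε hεa.le
  have hgb : gap H a ε < b := by
    have : ε < b / A := hεδ.trans_le (min_le_right _ _)
    rw [lt_div_iff₀ hA0] at this
    linarith
  -- Strict even when `A * B = 1`, by strict convexity; the room for `e` comes from here.
  have hgg : gap H b (gap H a ε) < ε :=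
    calc gap H b (gap H a ε) < B * gap H a ε := hH.gap_lt hb.2.le hga0 hgb.le hB
      _ ≤ B * (A * ε) := by gcongr
      _ = (A * B) * ε := by ring
      _ ≤ 1 * ε := by gcongr
      _ = ε := one_mul ε
  obtain ⟨e, he, heε⟩ := exists_between hgg
  have he0 : 0 < e := (hH.gap_pos hb.2.le hga0 hgb.le).trans he
  have t1 : Tendsto (fun n => gap H (m n) ε) atTop (𝓝 (gap H a ε)) :=
    hH.tendsto_gap hma tendsto_const_nhds ha.2 hε.le hεa
  have t2 : Tendsto (fun n => gap H (1 - H (m n)) (gap H (m n) ε)) atTop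
      (𝓝 (gap H b (gap H a ε))) := hH.tendsto_gap hmb t1 hb.2 hga0.le hgb
  -- For large `n` the step from `ε` lands below `e`. Monotonicity handles `v n ≤ ε`; for `v n > ε`,
  -- subhomogeneity with `t = ε / v n` bounds the contraction ratio by `e / ε`.
  refine ⟨e / ε, by positivity, (div_lt_one hε).2 heε, ?_⟩
  filter_upwards [t2.eventually (gt_mem_nhds he), hma.eventually (lt_mem_nhds hεa),
    (hmb.sub t1).eventually (lt_mem_nhds (sub_pos.2 hgb))] with n h1 h2 h3
  have hm1 := (hm n).2
  have hm1' := (hH.one_sub_mem (hm n)).2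
  rw [hv', hu]
  rcases le_or_gt (v n) ε with h | h
  · rw [max_eq_right h, div_mul_cancel₀ _ hε.ne']
    refine le_trans ?_ h1.le
    have h4 : gap H (m n) (v n) ≤ gap H (m n) ε := hH.gap_mono hm1 (hv n) h h2.le
    have h5 : 0 ≤ gap H (m n) (v n) := by
      rcases (hv n).eq_or_lt with h6 | h6
      · rw [← h6]; simp [gap]
      · exact (hH.gap_pos hm1 h6 (hvm n)).le
    exact hH.gap_mono hm1' h5 h4 (by linarith)
  · rw [max_eq_left h.le]
    have hv0 := hε.trans h
    have h4 := hH.mul_gap_gap_lt hm1 hm1' hv0 (hvm n) (hu n ▸ hum n) (t := ε / v n)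
      (by positivity) ((div_lt_one hv0).2 h)
    rw [div_mul_cancel₀ _ hv0.ne'] at h4
    have h5 := h4.trans h1
    rw [div_mul_eq_mul_div, div_lt_iff₀ hv0] at h5
    rw [div_mul_eq_mul_div, le_div_iff₀ hε]
    linarith

/-- If the linearization at `a` is expanding, then all the positive variances converge to the
same positive limit. -/
theorem exists_tendsto_gap {a b A B : ℝ} (ha : a ∈ Set.Ioo (0 : ℝ) 1)
    (hb : b ∈ Set.Ioo (0 : ℝ) 1) (hA : HasDerivAt H A a) (hB : HasDerivAt H B b)
    (hAB : 1 < A * B) {w wu : ℕ → ℝ} (hw : ∀ n, w n < a) (hw0 : ∀ n, w n ≤ w 0) (hwp : 0 < w 0)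
    (hwu : ∀ n, wu n = gap H a (w n)) (hwub : ∀ n, wu n < b)
    (hw' : ∀ n, w (n + 1) = gap H b (wu n)) :
    ∃ l, 0 < l ∧ ∀ v : ℕ → ℝ, 0 < v 0 → (∀ n, v n ≤ w n) →
      (∀ n, v (n + 1) = gap H b (gap H a (v n))) → Tendsto v atTop (𝓝 l) := by
  set Φ : ℝ → ℝ := fun x => gap H b (gap H a x) with hΦ
  have hwΦ : ∀ n, w (n + 1) = Φ (w n) := fun n => by rw [hw', hwu]
  have hpos : ∀ v : ℕ → ℝ, 0 < v 0 → (∀ n, v n ≤ w n) → (∀ n, v (n + 1) = Φ (v n)) →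
      ∀ n, 0 < v n := fun v h0 hle hrec n => by
    induction n with
    | zero => exact h0
    | succ n ih =>
      rw [hrec]
      refine hH.gap_pos hb.2.le (hH.gap_pos ha.2.le ih ((hle n).trans (hw n).le)) ?_
      refine (hH.gap_mono ha.2.le ih.le (hle n) (hw n).le).trans ?_
      rw [← hwu]; exact (hwub n).le
  have hwpos := hpos w hwp (fun _ => le_rfl) hwΦ
  have hmono : ∀ x y, 0 ≤ x → x ≤ y → y ≤ a → gap H a y ≤ b → Φ x ≤ Φ y := by
    intro x y hx hxy hya hyb
    refine hH.gap_mono hb.2.le ?_ (hH.gap_mono ha.2.le hx hxy hya) hyb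
    have := hH.gap_mono ha.2.le le_rfl hx (hxy.trans hya)
    simpa [gap] using this
  -- The orbit of a monotone map decreases once its first step does.
  have hanti : Antitone w := by
    refine antitone_nat_of_succ_le fun n => ?_
    induction n with
    | zero => exact hw0 1
    | succ n ih =>
      calc w (n + 1 + 1) = Φ (w (n + 1)) := hwΦ _
        _ ≤ Φ (w n) := hmono _ _ (hwpos _).le ih (hw n).le (hwu n ▸ (hwub n).le)
        _ = w (n + 1) := (hwΦ n).symm
  have hbdd : BddBelow (Set.range w) := ⟨0, by rintro _ ⟨n, rfl⟩; exact (hwpos n).le⟩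
  set l := ⨅ n, w n with hl
  have hwl : Tendsto w atTop (𝓝 l) := tendsto_atTop_ciInf hanti hbdd
  have hl0 : 0 ≤ l := le_ciInf fun n => (hwpos n).le
  have hlw : ∀ n, l ≤ w n := fun n => ciInf_le hbdd n
  have hla : l < a := (hlw 0).trans_lt (hw 0)
  have hcont : ∀ (v : ℕ → ℝ) (x : ℝ), Tendsto v atTop (𝓝 x) → 0 ≤ x → x ≤ l →
      (∀ n, v (n + 1) = Φ (v n)) → Φ x = x := by
    intro v x hvx hx hxl hrec
    have t1 : Tendsto (fun n => gap H a (v n)) atTop (𝓝 (gap H a x)) :=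
      hH.tendsto_gap tendsto_const_nhds hvx ha.2 hx (hxl.trans_lt hla)
    have hx0 : 0 ≤ gap H a x := by
      have := hH.gap_mono ha.2.le le_rfl hx (hxl.trans hla.le)
      simpa [gap] using this
    have hxb : gap H a x < b := by
      refine lt_of_le_of_lt ?_ (hwub 0)
      rw [hwu]
      exact hH.gap_mono ha.2.le hx (hxl.trans (hlw 0)) (hw 0).le
    have t2 : Tendsto (fun n => Φ (v n)) atTop (𝓝 (Φ x)) :=
      hH.tendsto_gap tendsto_const_nhds t1 hb.2 hx0 hxb
    refine tendsto_nhds_unique t2 ?_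
    have := hvx.comp (tendsto_add_atTop_nat 1)
    refine this.congr fun n => ?_
    simp [Function.comp, hrec]
  have hΦl := hcont w l hwl hl0 le_rfl hwΦ
  -- A zero limit would make `w` eventually increase, as the slope of `Φ` at `0` is `B * A > 1`.
  have hlpos : 0 < l := by
    refine hl0.lt_of_ne fun h0 => ?_
    have hder : HasDerivAt Φ (B * A) 0 := by
      have d1 : HasDerivAt (gap H a) A 0 := by
        have hA' : HasDerivAt H A (a - 0) := by simpa using hA
        have := (hA'.comp_const_sub a 0).const_sub (H a)
        rw [neg_neg] at this
        exact this
      have d2 : HasDerivAt (gap H b) B (gap H a 0) := by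
        have hB' : HasDerivAt H B (b - gap H a 0) := by simpa [gap] using hB
        have := (hB'.comp_const_sub b (gap H a 0)).const_sub (H b)
        rw [neg_neg] at this
        exact this
      exact d2.comp 0 d1
    have ht : Tendsto w atTop (𝓝[≠] 0) :=
      tendsto_nhdsWithin_iff.2 ⟨by simpa [← h0] using hwl,
        Eventually.of_forall fun n => (hwpos n).ne'⟩
    have hs := ((hasDerivAt_iff_tendsto_slope.1 hder).comp ht).eventually
      (lt_mem_nhds (show 1 < B * A by linarith))
    obtain ⟨n, hn⟩ := hs.exists
    have hΦ0 : Φ 0 = 0 := by simp [hΦ, gap]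
    simp only [Function.comp, slope_def_field, hΦ0, sub_zero] at hn
    rw [lt_div_iff₀ (hwpos n), one_mul, ← hwΦ] at hn
    exact hn.not_ge (hanti (Nat.le_succ n))
  refine ⟨l, hlpos, fun v hv0 hvw hrec => ?_⟩
  have hvpos := hpos v hv0 hvw hrec
  -- By subhomogeneity `r` increases, so `v` converges to a multiple `ρ * l`. Both `l` and `ρ * l`
  -- are fixed by `Φ`, which strict subhomogeneity excludes for `ρ < 1`.
  set r : ℕ → ℝ := fun n => v n / w n with hr
  have hr0 : ∀ n, 0 < r n := fun n => div_pos (hvpos n) (hwpos n)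
  have hr1 : ∀ n, r n ≤ 1 := fun n => (div_le_one (hwpos n)).2 (hvw n)
  have hrv : ∀ n, r n * w n = v n := fun n => div_mul_cancel₀ _ (hwpos n).ne'
  have hrmono : Monotone r := by
    refine monotone_nat_of_le_succ fun n => ?_
    rw [hr]
    simp only
    rw [le_div_iff₀ (hwpos _), hrec, hwΦ, ← hrv n, mul_div_assoc, div_self (hwpos n).ne', mul_one]
    rcases (hr1 n).eq_or_lt with h | h
    · rw [h, one_mul, one_mul]
    · exact (hH.mul_gap_gap_lt ha.2.le hb.2.le (hwpos n) (hw n).le (hwu n ▸ (hwub n).le)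
        (hr0 n) h).le
  have hbddr : BddAbove (Set.range r) := ⟨1, by rintro _ ⟨n, rfl⟩; exact hr1 n⟩
  set ρ := ⨆ n, r n with hρ
  have hrρ : Tendsto r atTop (𝓝 ρ) := tendsto_atTop_ciSup hrmono hbddr
  have hρ0 : 0 < ρ := (hr0 0).trans_le (le_ciSup hbddr 0)
  have hρ1 : ρ ≤ 1 := ciSup_le hr1
  have hvl : Tendsto v atTop (𝓝 (ρ * l)) := (hrρ.mul hwl).congr hrv
  have hfix := hcont v (ρ * l) hvl (by positivity) (by nlinarith) hrec
  rcases hρ1.eq_or_lt with h | h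
  · rwa [h, one_mul] at hvl
  · have hgl : gap H a l ≤ b := by
      refine le_trans ?_ (hwub 0).le
      rw [hwu]
      exact hH.gap_mono ha.2.le hl0 (hlw 0) (hw 0).le
    have := hH.mul_gap_gap_lt ha.2.le hb.2.le hlpos hla.le hgl hρ0 h
    change ρ * Φ l < Φ (ρ * l) at this
    rw [hΦl, hfix] at this
    exact absurd this (lt_irrefl _)

end IsGenFun

/-! ### The generating function -/

theorem measurable_enatPow (s : ℝ) : Measurable (enatPow s) := .of_discrete

theorem enatPow_mem {s : ℝ} (hs : s ∈ Set.Icc (0 : ℝ) 1) (n : ℕ∞) :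
    enatPow s n ∈ Set.Icc (0 : ℝ) 1 := by
  rw [← liveProd_const n ⟨s, hs⟩]
  exact Subtype.prop _

theorem integrable_enatPow (d : ProbabilityMeasure ℕ∞) {s : ℝ} (hs : s ∈ Set.Icc (0 : ℝ) 1) :
    Integrable (enatPow s) (d : Measure ℕ∞) := by
  refine Integrable.of_bound (C := 1) (measurable_enatPow s).aestronglyMeasurable ?_
  filter_upwards with n
  rw [Real.norm_eq_abs, abs_of_nonneg (enatPow_mem hs n).1]
  exact (enatPow_mem hs n).2

theorem pgf_one (d : ProbabilityMeasure ℕ∞) : pgf d 1 = 1 := by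
  simp [pgf, enatPow]

theorem pgf_nonneg (d : ProbabilityMeasure ℕ∞) {s : ℝ} (hs : s ∈ Set.Icc (0 : ℝ) 1) :
    0 ≤ pgf d s :=
  integral_nonneg fun n => (enatPow_mem hs n).1

theorem mul_pow_pred_le {r : ℝ} (h0 : 0 ≤ r) (h1 : r < 1) (n : ℕ) :
    n * r ^ (n - 1) ≤ 1 / (1 - r) := by
  have h2 : ∑ _k ∈ Finset.range n, r ^ (n - 1) ≤ ∑ k ∈ Finset.range n, r ^ k :=
    Finset.sum_le_sum fun k hk =>
      pow_le_pow_of_le_one h0 h1.le (by have := Finset.mem_range.1 hk; omega)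
  have h3 : ∑ k ∈ Finset.range n, r ^ k ≤ 1 / (1 - r) := by
    rw [geom_sum_eq h1.ne, ← neg_div_neg_eq, neg_sub, neg_sub]
    exact div_le_div_of_nonneg_right (by linarith [pow_nonneg h0 n]) (by linarith)
  simpa using h2.trans h3

theorem differentiableAt_pgf (d : ProbabilityMeasure ℕ∞) {s : ℝ} (hs : s ∈ Set.Ioo (0 : ℝ) 1) :
    DifferentiableAt ℝ (pgf d) s := by
  obtain ⟨r, hsr, hr1⟩ := exists_between hs.2
  have hr0 : 0 < r := hs.1.trans hsr
  have hmem : Set.Ioo 0 r ∈ 𝓝 s := Ioo_mem_nhds hs.1 hsr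
  refine (hasDerivAt_integral_of_dominated_loc_of_deriv_le (bound := fun _ => 1 / (1 - r))
    -- The term `n = ⊤` is identically `0` near any point below `1`; the others are dominated
    -- uniformly on `(0, r)`.
    (F' := fun x n => if n = ⊤ then 0 else n.toNat * x ^ (n.toNat - 1)) hmem
    (Eventually.of_forall fun x => (measurable_enatPow x).aestronglyMeasurable)
    (integrable_enatPow d ⟨hs.1.le, hs.2.le⟩) Measurable.of_discrete.aestronglyMeasurable
    ?_ (integrable_const _) ?_).2.differentiableAt
  · refine Eventually.of_forall fun n x hx => ?_
    split_ifs with hn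
    · simp only [norm_zero]
      exact div_nonneg zero_le_one (by linarith)
    · rw [Real.norm_eq_abs, abs_of_nonneg (by have := hx.1; positivity)]
      refine le_trans ?_ (mul_pow_pred_le hr0.le hr1 n.toNat)
      have := hx.1
      have := hx.2.le
      gcongr
  · refine Eventually.of_forall fun n x hx => ?_
    split_ifs with hn
    · refine (hasDerivAt_const x (0 : ℝ)).congr_of_eventuallyEq ?_
      filter_upwards [gt_mem_nhds (hx.2.trans hr1)] with y hy
      simp [enatPow, hn, hy.ne]
    · simpa [enatPow, hn] using hasDerivAt_pow n.toNat x

theorem isGenFun_pgf (d : ProbabilityMeasure ℕ∞) (h0 : pgf d 0 = 0)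
    (hconv : StrictConvexOn ℝ (Set.Icc (0 : ℝ) 1) (pgf d)) : IsGenFun (pgf d) where
  zero := h0
  one := pgf_one d
  nonneg _ hs := pgf_nonneg d hs
  convex := hconv
  diff _ hs := differentiableAt_pgf d hs

/-! ### Weak convergence -/

section Weak

variable {K : Type*} [TopologicalSpace K] [CompactSpace K]

/-- On the compact set where `|g| ≥ ε` the function `h` has a positive minimum. Hence small
integrals of `h` force small integrals of any `g` vanishing on its zero set. -/
theorem exists_abs_le_add_mul {g h : K → ℝ} (hg : Continuous g) (hh : Continuous h)
    (h0 : ∀ x, 0 ≤ h x) (hgh : ∀ x, h x = 0 → g x = 0) {ε : ℝ} (hε : 0 < ε) :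
    ∃ C, 0 < C ∧ ∀ x, |g x| ≤ ε + C * h x := by
  have hcl : IsCompact {x | ε ≤ |g x|} := (isClosed_le continuous_const hg.abs).isCompact
  rcases Set.eq_empty_or_nonempty {x | ε ≤ |g x|} with he | hne
  · refine ⟨1, one_pos, fun x => ?_⟩
    have hx : x ∉ {x | ε ≤ |g x|} := by simp [he]
    have := not_le.1 (show ¬ ε ≤ |g x| from hx)
    linarith [h0 x]
  · obtain ⟨y, hy, hymin⟩ := hcl.exists_isMinOn hne hh.continuousOn
    obtain ⟨z, hz, hzmax⟩ := hcl.exists_isMaxOn hne hg.abs.continuousOn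
    have hgz : 0 < |g z| := hε.trans_le hz
    have hhy : 0 < h y := (h0 y).lt_of_ne fun h => by
      have := hgh y h.symm
      have hy' : ε ≤ |g y| := hy
      rw [this, abs_zero] at hy'
      exact hε.not_ge hy'
    refine ⟨|g z| / h y, by positivity, fun x => ?_⟩
    have hx0 : 0 ≤ |g z| / h y * h x := mul_nonneg (by positivity) (h0 x)
    by_cases hx : ε ≤ |g x|
    · have h1 : |g x| ≤ |g z| := hzmax hx
      have h2 : h y ≤ h x := hymin hx
      have h3 : |g z| ≤ |g z| / h y * h x := by
        rw [div_mul_eq_mul_div, le_div_iff₀ hhy]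
        gcongr
      linarith
    · linarith [lt_of_not_ge hx]

variable [MeasurableSpace K] [BorelSpace K]

theorem integrable_of_continuous (ν : ProbabilityMeasure K) {g : K → ℝ} (hg : Continuous g) :
    Integrable g (ν : Measure K) :=
  hg.integrable_of_hasCompactSupport (HasCompactSupport.of_compactSpace g)

theorem tendsto_integral_zero {g h : K → ℝ} (hg : Continuous g) (hh : Continuous h)
    (h0 : ∀ x, 0 ≤ h x) (hgh : ∀ x, h x = 0 → g x = 0) {ν : ℕ → ProbabilityMeasure K}
    (hν : Tendsto (fun n => ∫ x, h x ∂(ν n : Measure K)) atTop (𝓝 0)) :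
    Tendsto (fun n => ∫ x, g x ∂(ν n : Measure K)) atTop (𝓝 0) := by
  rw [Metric.tendsto_atTop]
  intro e he
  obtain ⟨C, hC, hle⟩ := exists_abs_le_add_mul hg hh h0 hgh (half_pos he)
  obtain ⟨n₀, hn₀⟩ := eventually_atTop.1 (hν.eventually (gt_mem_nhds (show 0 < e / 2 / C by
    positivity)))
  refine ⟨n₀, fun n hn => ?_⟩
  have h1 := hn₀ n hn
  rw [lt_div_iff₀ hC] at h1
  have ih := (integrable_of_continuous (ν n) hh).const_mul C
  rw [Real.dist_eq, sub_zero]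
  calc |∫ x, g x ∂(ν n : Measure K)| ≤ ∫ x, |g x| ∂(ν n : Measure K) := abs_integral_le_integral_abs
    _ ≤ ∫ x, (e / 2 + C * h x) ∂(ν n : Measure K) :=
        integral_mono (integrable_of_continuous _ hg.abs) ((integrable_const _).add ih) hle
    _ = e / 2 + C * ∫ x, h x ∂(ν n : Measure K) := by
        rw [integral_add (integrable_const _) ih, integral_const_mul]; simp
    _ < e := by linarith

end Weak

/-- If the variance of a mark with values in `{0,1}` is approached, then integrals are determined
by the mean. -/
theorem tendsto_integral_of_tendsto_mean {ν : ℕ → ProbabilityMeasure I} {a : ℝ}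
    (hmean : Tendsto (fun n => mean (ν n)) atTop (𝓝 a))
    (hvar : Tendsto (fun n => mean (ν n) - secondMoment (ν n)) atTop (𝓝 0)) (f : C(I, ℝ)) :
    Tendsto (fun n => ∫ x, f x ∂(ν n : Measure I)) atTop (𝓝 ((1 - a) * f 0 + a * f 1)) := by
  -- The difference between `f` and its linear interpolation vanishes at `0` and `1`, the zeros of
  -- `x * (1 - x)`.
  have h1 : Tendsto (fun n => ∫ x : I, (f x - (1 - (x : ℝ)) * f 0 - x * f 1) ∂(ν n : Measure I))
      atTop (𝓝 0) := by
    refine tendsto_integral_zero (h := fun x : I => (x : ℝ) * (1 - x)) (by fun_prop) (by fun_prop)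
      (fun x => mul_nonneg x.2.1 (sub_nonneg.2 x.2.2)) (fun x hx => ?_) ?_
    · rcases mul_eq_zero.1 hx with h | h
      · have : x = 0 := Subtype.ext h
        subst this; simp
      · have : x = 1 := Subtype.ext (by simpa using (sub_eq_zero.1 h).symm)
        subst this; simp
    · simpa only [mean_sub_secondMoment] using hvar
  have h2 : Tendsto (fun n => (1 - mean (ν n)) * f 0 + mean (ν n) * f 1) atTop
      (𝓝 ((1 - a) * f 0 + a * f 1)) :=
    ((hmean.const_sub 1).mul_const _).add (hmean.mul_const _)
  have h3 := h1.add h2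
  rw [zero_add] at h3
  refine h3.congr fun n => ?_
  have i1 := integrable_of_continuous (ν n) f.continuous
  have i2 : Integrable (fun x : I => (1 - (x : ℝ)) * f 0) (ν n : Measure I) :=
    integrable_of_continuous (ν n) (by fun_prop)
  have i3 : Integrable (fun x : I => (x : ℝ) * f 1) (ν n : Measure I) :=
    integrable_of_continuous (ν n) (by fun_prop)
  have i12 : Integrable (fun x : I => f x - (1 - (x : ℝ)) * f 0) (ν n : Measure I) := i1.sub i2
  rw [integral_sub i12 i3, integral_sub i1 i2, integral_mul_const, integral_mul_const,
    integral_sub (integrable_const _) (integrable_coe _)]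
  simp only [mean, integral_const, probReal_univ, smul_eq_mul, mul_one]
  ring

theorem tendsto_mean {ν : ℕ → ProbabilityMeasure I} {π : ProbabilityMeasure I}
    (h : Tendsto ν atTop (𝓝 π)) : Tendsto (fun n => mean (ν n)) atTop (𝓝 (mean π)) :=
  ProbabilityMeasure.tendsto_iff_forall_integral_tendsto.1 h
    (BoundedContinuousFunction.mkOfCompact ⟨fun x : I => (x : ℝ), continuous_subtype_val⟩)

theorem tendsto_secondMoment {ν : ℕ → ProbabilityMeasure I} {π : ProbabilityMeasure I}
    (h : Tendsto ν atTop (𝓝 π)) :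
    Tendsto (fun n => secondMoment (ν n)) atTop (𝓝 (secondMoment π)) :=
  ProbabilityMeasure.tendsto_iff_forall_integral_tendsto.1 h
    (BoundedContinuousFunction.mkOfCompact ⟨fun x : I => (x : ℝ) * x, by fun_prop⟩)

/-- Couplings that get close in mean square have the same weak limits. -/
theorem tendsto_of_coupling {ν ν' : ℕ → ProbabilityMeasure I} {π : ProbabilityMeasure I}
    {γ : ℕ → ProbabilityMeasure (I × I)}
    (hγ : ∀ n, (γ n : Measure (I × I)).map Prod.fst = ν n)
    (hγ' : ∀ n, (γ n : Measure (I × I)).map Prod.snd = ν' n)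
    (hdist : Tendsto (fun n => ∫ p : I × I, ((p.1 : ℝ) - p.2) ^ 2 ∂(γ n : Measure (I × I)))
      atTop (𝓝 0))
    (h : Tendsto ν' atTop (𝓝 π)) : Tendsto ν atTop (𝓝 π) := by
  rw [ProbabilityMeasure.tendsto_iff_forall_integral_tendsto] at h ⊢
  intro f
  have h1 : Tendsto (fun n => ∫ p : I × I, (f p.1 - f p.2) ∂(γ n : Measure (I × I)))
      atTop (𝓝 0) := by
    refine tendsto_integral_zero (h := fun p : I × I => ((p.1 : ℝ) - p.2) ^ 2) (by fun_prop)
      (by fun_prop) (fun p => sq_nonneg _) (fun p hp => ?_) hdist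
    have : p.1 = p.2 := Subtype.ext (sub_eq_zero.1 (pow_eq_zero_iff two_ne_zero |>.1 hp))
    rw [this, sub_self]
  have h3 := h1.add (h f)
  rw [zero_add] at h3
  refine h3.congr fun n => ?_
  have i1 : Integrable (fun p : I × I => f p.1) (γ n : Measure (I × I)) :=
    integrable_of_continuous (γ n) (by fun_prop)
  have i2 : Integrable (fun p : I × I => f p.2) (γ n : Measure (I × I)) :=
    integrable_of_continuous (γ n) (by fun_prop)
  rw [integral_sub i1 i2, ← hγ n, ← hγ' n,
    integral_map measurable_fst.aemeasurable f.continuous.measurable.aestronglyMeasurable,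
    integral_map measurable_snd.aemeasurable f.continuous.measurable.aestronglyMeasurable]
  ring

/-! ### Evaluation of the recursion on the tree -/

/-- The value at the vertex `u` after `k` steps of the recursion with family sizes `ν`, started
from the values `s`. -/
def treeEval : ℕ → (Vertex → ℕ∞) → (Vertex → I) → Vertex → I
  | 0, _, s, u => s u
  | k + 1, ν, s, u => rdeMap (ν u, fun i => treeEval k ν s (i :: u))

theorem treeEval_congr (k : ℕ) {ν ν' : Vertex → ℕ∞} {s s' : Vertex → I} (u : Vertex)
    (hν : ∀ v, v.length < u.length + k → ν v = ν' v)
    (hs : ∀ v, v.length = u.length + k → s v = s' v) :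
    treeEval k ν s u = treeEval k ν' s' u := by
  induction k generalizing u with
  | zero => exact hs u rfl
  | succ k ih =>
    simp only [treeEval]
    rw [hν u (by omega)]
    congr 2
    funext i
    refine ih (i :: u) (fun v hv => hν v ?_) fun v hv => hs v ?_
    · rw [List.length_cons] at hv; omega
    · rw [List.length_cons] at hv; omega

theorem treeEval_append (k : ℕ) (ν : Vertex → ℕ∞) (s : Vertex → I) (u w : Vertex) :
    treeEval k ν s (u ++ w) = treeEval k (fun v => ν (v ++ w)) (fun v => s (v ++ w)) u := by
  induction k generalizing u with
  | zero => rfl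
  | succ k ih =>
    simp only [treeEval]
    congr 2
    funext i
    exact ih (i :: u)

theorem measurable_treeEval {X : Type*} [MeasurableSpace X] (k : ℕ) {ν : X → Vertex → ℕ∞}
    {s : X → Vertex → I} (hν : ∀ v, Measurable fun x => ν x v)
    (hs : ∀ v, Measurable fun x => s x v) (u : Vertex) :
    Measurable fun x => treeEval k (ν x) (s x) u := by
  induction k generalizing u with
  | zero => exact hs u
  | succ k ih =>
    exact measurable_rdeMap.comp ((hν u).prodMk (measurable_pi_lambda _ fun i => ih (i :: u)))

/-- Currying a product measure turns it into a product of products. -/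
theorem iIndepFun_blocks {Ω A B X : Type*} [MeasurableSpace Ω] {P : Measure Ω}
    [MeasurableSpace X] {Y : A × B → Ω → X} (hm : ∀ p, Measurable (Y p)) (h : iIndepFun Y P) :
    iIndepFun (fun (a : A) ω (b : B) => Y (a, b) ω) P := by
  have := h.isProbabilityMeasure
  have hp : ∀ a b, IsProbabilityMeasure (P.map (Y (a, b))) :=
    fun a b => Measure.isProbabilityMeasure_map (hm _).aemeasurable
  rw [iIndepFun_iff_map_fun_eq_infinitePi_map (by fun_prop)]
  have h1 := h.map_fun_eq_infinitePi_map hm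
  have h2 := Measure.infinitePi_map_curry fun a b => P.map (Y (a, b))
  have h3 : ∀ a, Measure.infinitePi (fun b => P.map (Y (a, b)))
      = P.map (fun ω b => Y (a, b) ω) := fun a =>
    ((h.precomp (Prod.mk_right_injective a)).map_fun_eq_infinitePi_map fun b => hm (a, b)).symm
  simp only [h3] at h2
  rw [← h2]
  change _ = (Measure.infinitePi fun p => P.map (Y p)).map _
  rw [← h1, Measure.map_map (by fun_prop) (by fun_prop)]
  rfl

/-! ### Independence and means for frozen family sizes -/

section Means

variable {Ω : Type*} [MeasurableSpace Ω] {P : Measure Ω} [IsProbabilityMeasure P]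

theorem meanI_rdeMap {Y : ℕ → Ω → I} (hY : ∀ i, Measurable (Y i)) (hind : iIndepFun Y P)
    (n : ℕ∞) : meanI P (fun ω => rdeMap (n, fun i => Y i ω))
      = rdeMap (n, fun i => meanI P (Y i)) := by
  have hm : Measurable fun ω => liveProd n fun i => Y i ω :=
    measurable_liveProd.comp (f := fun ω => (n, fun i => Y i ω)) (by fun_prop)
  have hm' : Measurable fun ω => rdeMap (n, fun i => Y i ω) :=
    measurable_rdeMap.comp (by fun_prop)
  refine Subtype.ext ?_
  rw [coe_meanI P hm']
  change ∫ ω, (1 - (liveProd n (fun i => Y i ω) : ℝ)) ∂P = 1 - (liveProd n _ : ℝ)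
  rw [integral_sub (integrable_const _) (integrable_unitInterval P hm), integral_liveProd P hY hind]
  simp

/-- For fixed family sizes the recursion preserves independence, and commutes with means. -/
theorem iIndepFun_treeEval {Y : Vertex → Ω → I} (hY : ∀ w, Measurable (Y w)) (ν : Vertex → ℕ∞)
    (k m : ℕ) (hind : iIndepFun (fun u : {u : Vertex // u.length = m + k} => Y u) P) :
    iIndepFun (fun (u : {u : Vertex // u.length = m}) ω => treeEval k ν (fun w => Y w ω) u) P ∧
      ∀ u : Vertex, u.length = m → meanI P (fun ω => treeEval k ν (fun w => Y w ω) u)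
        = treeEval k ν (fun w => meanI P (Y w)) u := by
  induction k generalizing m with
  | zero => exact ⟨hind, fun u _ => rfl⟩
  | succ k ih =>
    obtain ⟨h1, h2⟩ := ih (m + 1) (by rwa [show m + 1 + k = m + (k + 1) by ring])
    have hmeas : ∀ u, Measurable fun ω => treeEval k ν (fun w => Y w ω) u :=
      fun u => measurable_treeEval k (ν := fun _ => ν) (fun _ => measurable_const) hY u
    constructor
    · have h3 : iIndepFun (fun (p : {u : Vertex // u.length = m} × ℕ) ω =>
          treeEval k ν (fun w => Y w ω) (p.2 :: p.1)) P := by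
        refine h1.precomp (g := fun p : {u : Vertex // u.length = m} × ℕ =>
          (⟨p.2 :: p.1, by simp [p.1.2]⟩ : {u : Vertex // u.length = m + 1})) ?_
        rintro ⟨⟨u, hu⟩, i⟩ ⟨⟨v, hv⟩, j⟩ h
        simp only [Subtype.mk.injEq, List.cons.injEq] at h
        simp [h.1, h.2]
      have h4 := iIndepFun_blocks (fun p => hmeas _) h3
      exact h4.comp (fun u x => rdeMap (ν u, x)) fun u => measurable_rdeMap.comp (by fun_prop)
    · intro u hu
      have h3 : iIndepFun (fun (i : ℕ) ω => treeEval k ν (fun w => Y w ω) (i :: u)) P := by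
        refine h1.precomp (g := fun i : ℕ =>
          (⟨i :: u, by simp [hu]⟩ : {u : Vertex // u.length = m + 1})) ?_
        intro i j h
        simpa using h
      simp only [treeEval]
      rw [meanI_rdeMap (fun i => hmeas _) h3]
      congr 2
      funext i
      exact h2 (i :: u) (by simp [hu])

end Means

/-! ### The law of the recursion on the tree -/

/-- The law of the independent family sizes on the tree. -/
abbrev treeLaw (d : ProbabilityMeasure ℕ∞) : Measure (Vertex → ℕ∞) :=
  Measure.infinitePi fun _ : Vertex => (d : Measure ℕ∞)

/-- The branching property: the subtrees at the daughters are independent copies of the tree,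
independent of the root. Addresses are read from the right, so `w ++ [i]` is the vertex `w` of the
subtree at daughter `i`. -/
theorem map_treeLaw (d : ProbabilityMeasure ℕ∞) :
    (treeLaw d).map (fun ν => (ν [], fun (i : ℕ) (w : Vertex) => ν (w ++ [i])))
      = nodeLaw d (treeLaw d) := by
  have hind : iIndepFun (fun (v : Vertex) (ν : Vertex → ℕ∞) => ν v) (treeLaw d) :=
    iIndepFun_infinitePi (X := fun _ x => x) fun _ => measurable_id
  have hI : IndepFun (fun ν : Vertex → ℕ∞ => ν [])
      (fun (ν : Vertex → ℕ∞) (i : ℕ) (w : Vertex) => ν (w ++ [i])) (treeLaw d) := by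
    have h1 := indep_iSup_of_disjoint (fun v => (measurable_pi_apply v).comap_le) hind
      (S := {[]}) (T := {[]}ᶜ) disjoint_compl_right
    refine indep_of_indep_of_le_left (indep_of_indep_of_le_right h1 ?_) ?_
    · rw [← measurable_iff_comap_le, @measurable_pi_iff]
      intro i
      rw [@measurable_pi_iff]
      intro w
      rw [measurable_iff_comap_le]
      exact le_iSup₂_of_le (w ++ [i]) (by simp) le_rfl
    · exact le_iSup₂_of_le [] rfl le_rfl
  rw [hI.map_prod_eq_prod_map_map (measurable_pi_apply _).aemeasurable
    (Measurable.aemeasurable (by fun_prop))]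
  congr 1
  · exact Measure.infinitePi_map_eval (fun _ : Vertex => (d : Measure ℕ∞)) []
  · have hinj : Function.Injective fun p : ℕ × Vertex => p.2 ++ [p.1] := by
      rintro ⟨i, u⟩ ⟨j, v⟩ h
      have := List.append_inj' h rfl
      simp_all
    have h2 := Measure.map_infinitePi_infinitePi_of_inj
      (P := fun _ : Vertex => (d : Measure ℕ∞)) hinj
    have h3 := Measure.infinitePi_map_curry fun (_ : ℕ) (_ : Vertex) => (d : Measure ℕ∞)
    rw [← h3]
    change _ = (Measure.infinitePi fun _ : ℕ × Vertex => (d : Measure ℕ∞)).map _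
    rw [← h2, Measure.map_map (by fun_prop) (by fun_prop)]
    rfl

/-- The law of a constant. -/
def diracLaw (c : I) : ProbabilityMeasure I := ⟨Measure.dirac c, inferInstance⟩

theorem map_treeEval (d : ProbabilityMeasure ℕ∞) (c : I) (k : ℕ) :
    (treeLaw d).map (fun ν => treeEval k ν (fun _ => c) [])
      = ((rdeLaw d)^[k] (diracLaw c) : ProbabilityMeasure I) := by
  induction k with
  | zero => simp [treeEval]; rfl
  | succ k ih =>
    have hm : Measurable fun ν : Vertex → ℕ∞ => treeEval k ν (fun _ => c) [] :=
      measurable_treeEval k (fun v => measurable_pi_apply v) (fun _ => measurable_const) _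
    rw [Function.iterate_succ_apply', ← map_nodeMap d (treeLaw d) hm _ ih, ← map_treeLaw d,
      Measure.map_map (measurable_nodeMap hm) (by fun_prop)]
    congr 1
    funext ν
    simp only [treeEval, Function.comp]
    congr 2
    funext i
    exact treeEval_append k ν (fun _ => c) [] [i]

/-! ### Conditional expectations -/

/-- Fubini for the joint law, a product by independence: `Y` is averaged with `X` frozen. -/
theorem setIntegral_comp_eq_of_indepFun {Ω A B : Type*} [MeasurableSpace Ω] {P : Measure Ω}
    [IsProbabilityMeasure P] [MeasurableSpace A] [MeasurableSpace B] {X : Ω → A} {Y : Ω → B}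
    (hX : Measurable X) (hY : Measurable Y) (h : IndepFun X Y P) {φ : A × B → I}
    (hφ : Measurable φ) {s : Set A} (hs : MeasurableSet s) :
    ∫ ω in X ⁻¹' s, (φ (X ω, Y ω) : ℝ) ∂P =
      ∫ ω in X ⁻¹' s, (∫ ω', (φ (X ω, Y ω') : ℝ) ∂P) ∂P := by
  have := Measure.isProbabilityMeasure_map (μ := P) hX.aemeasurable
  have := Measure.isProbabilityMeasure_map (μ := P) hY.aemeasurable
  have hφ' : Measurable fun p => (φ p : ℝ) := hφ.subtype_val
  have h1 : ∀ x, ∫ ω', (φ (x, Y ω') : ℝ) ∂P = ∫ y, (φ (x, y) : ℝ) ∂(P.map Y) := fun x =>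
    (integral_map hY.aemeasurable
      (hφ'.comp measurable_prodMk_left).aestronglyMeasurable (f := fun y => (φ (x, y) : ℝ))).symm
  simp only [h1]
  have h2 := setIntegral_map (μ := P) (g := X) (s := s)
    (f := fun x => ∫ y, (φ (x, y) : ℝ) ∂(P.map Y)) hs
    (hφ'.stronglyMeasurable.integral_prod_right'.aestronglyMeasurable) hX.aemeasurable
  rw [← h2]
  have h3 := setIntegral_map (μ := P) (g := fun ω => (X ω, Y ω)) (s := s ×ˢ Set.univ)
    (f := fun p => (φ p : ℝ)) (hs.prod MeasurableSet.univ) hφ'.aestronglyMeasurable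
    (hX.prodMk hY).aemeasurable
  rw [h.map_prod_eq_prod_map_map hX.aemeasurable hY.aemeasurable,
    setIntegral_prod _ (integrable_unitInterval _ hφ).integrableOn] at h3
  simp only [Measure.restrict_univ] at h3
  rw [h3]
  congr 2
  ext ω
  simp

/-- The noise strictly above level `n`. -/
abbrev noiseAbove {Ω : Type*} (N : Vertex → Ω → ℕ∞) (n : ℕ) : MeasurableSpace Ω :=
  MeasurableSpace.comap (fun ω => fun v : {v : Vertex // v.length < n} => N v ω) inferInstance

theorem measurable_noiseAbove {Ω : Type*} (N : Vertex → Ω → ℕ∞) {n : ℕ} {v : Vertex}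
    (hv : v.length < n) : Measurable[noiseAbove N n] (N v) :=
  (measurable_pi_apply (⟨v, hv⟩ : {v : Vertex // v.length < n})).comp
    (comap_measurable (fun ω => fun v : {v : Vertex // v.length < n} => N v ω))

theorem noiseAbove_mono {Ω : Type*} (N : Vertex → Ω → ℕ∞) : Monotone (noiseAbove N) := by
  intro m n hmn
  rw [noiseAbove, ← measurable_iff_comap_le, @measurable_pi_iff]
  exact fun v => measurable_noiseAbove N (v.2.trans_le hmn)

theorem iSup_noiseAbove {Ω : Type*} (N : Vertex → Ω → ℕ∞) : ⨆ n, noiseAbove N n = noise N := by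
  refine le_antisymm (iSup_le fun n => ?_) (iSup_le fun u => ?_)
  · rw [noiseAbove, ← measurable_iff_comap_le, @measurable_pi_iff]
    intro v
    rw [measurable_iff_comap_le]
    exact le_iSup (fun u => MeasurableSpace.comap (N u) inferInstance) (v : Vertex)
  · refine le_iSup_of_le (u.length + 1) ?_
    rw [← measurable_iff_comap_le]
    exact measurable_noiseAbove N (Nat.lt_succ_self _)

theorem noiseAbove_le {Ω : Type*} [m : MeasurableSpace Ω] {N : Vertex → Ω → ℕ∞}
    (hN : ∀ u, Measurable (N u)) (n : ℕ) : noiseAbove N n ≤ m :=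
  Measurable.comap_le (measurable_pi_iff.2 fun v => hN v)

/-! ### The conditional probability solution as a limit of iterates -/

namespace IsInterleavedDiscreteSolution

variable {Ω : Type*} [MeasurableSpace Ω] {P : Measure Ω} [IsProbabilityMeasure P]
  {d : ProbabilityMeasure ℕ∞} {a b : ℝ} {N : Vertex → Ω → ℕ∞} {S : Vertex → Ω → I}
  (hS : IsInterleavedDiscreteSolution P d a b N S)
include hS

omit [IsProbabilityMeasure P] in
theorem ae_eq_indicator (u : Vertex) :
    (fun ω => (S u ω : ℝ)) =ᵐ[P] {ω | S u ω = 1}.indicator fun _ => (1 : ℝ) := by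
  filter_upwards [hS.zero_or_one u] with ω hω
  rcases hω with h | h <;> simp [h]

omit [IsProbabilityMeasure P] in
theorem integral_eq (u : Vertex) : ∫ ω, (S u ω : ℝ) ∂P = if Even u.length then a else b := by
  rw [integral_congr_ae (hS.ae_eq_indicator u), ← hS.prob_one u]
  exact integral_indicator_one (hS.measurable_S u (measurableSet_singleton 1))

omit [IsProbabilityMeasure P] in
theorem ae_eq_treeEval (n : ℕ) (u : Vertex) :
    ∀ᵐ ω ∂P, S u ω = treeEval n (fun v => N v ω) (fun v => S v ω) u := by
  induction n generalizing u with
  | zero => exact Eventually.of_forall fun ω => rfl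
  | succ n ih =>
    filter_upwards [hS.recursion u, ae_all_iff.2 fun i => ih (i :: u)] with ω h1 h2
    rw [h1, treeEval]
    congr 2
    funext i
    exact h2 i

/-- The conditional law of the root given the noise above an even level. -/
theorem condExp_noiseAbove_ae_eq (ha : a ∈ Set.Icc (0 : ℝ) 1) {n : ℕ} (hn : Even n) :
    P[({ω | S [] ω = 1}.indicator fun _ => (1 : ℝ))|noiseAbove N n] =ᵐ[P]
      fun ω => (treeEval n (fun v => N v ω) (fun _ => ⟨a, ha⟩) [] : ℝ) := by
  set c : I := ⟨a, ha⟩ with hc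
  set X : Ω → {v : Vertex // v.length < n} → ℕ∞ := fun ω v => N v ω with hXdef
  set Y : Ω → {u : Vertex // u.length = n} → I := fun ω u => S u ω with hYdef
  have hX : Measurable X := measurable_pi_iff.2 fun v => hS.measurable_N v
  have hY : Measurable Y := measurable_pi_iff.2 fun v => hS.measurable_S v
  -- Extension by `0` to the whole tree; the evaluation from the root never reads the default
  -- values.
  set ex : ({v : Vertex // v.length < n} → ℕ∞) → Vertex → ℕ∞ :=
    fun x v => if h : v.length < n then x ⟨v, h⟩ else 0 with hex
  set ey : ({u : Vertex // u.length = n} → I) → Vertex → I :=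
    fun y v => if h : v.length = n then y ⟨v, h⟩ else 0 with hey
  have hexm : ∀ v, Measurable fun x => ex x v := fun v => by
    by_cases h : v.length < n
    · simpa only [hex, h, dif_pos] using measurable_pi_apply _
    · simp only [hex, h, dif_neg, not_false_eq_true]; exact measurable_const
  have heym : ∀ v, Measurable fun y => ey y v := fun v => by
    by_cases h : v.length = n
    · simpa only [hey, h, dif_pos] using measurable_pi_apply _
    · simp only [hey, h, dif_neg, not_false_eq_true]; exact measurable_const
  set φ : ({v : Vertex // v.length < n} → ℕ∞) × ({u : Vertex // u.length = n} → I) → I :=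
    fun p => treeEval n (ex p.1) (ey p.2) [] with hφdef
  have hφ : Measurable φ := measurable_treeEval n (fun v => (hexm v).comp measurable_fst)
    (fun v => (heym v).comp measurable_snd) []
  have hφS : ∀ᵐ ω ∂P, (φ (X ω, Y ω) : ℝ) = {ω | S [] ω = 1}.indicator (fun _ => (1 : ℝ)) ω := by
    filter_upwards [hS.ae_eq_treeEval n [], hS.ae_eq_indicator []] with ω h1 h2
    rw [← h2, h1]
    refine congrArg _ (treeEval_congr n [] (fun v hv => ?_) fun v hv => ?_)
    · have hv' : v.length < n := by simpa using hv
      simp [hex, hXdef, hv']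
    · have hv' : v.length = n := by simpa using hv
      simp [hey, hYdef, hv']
  have hcm : ∀ v : Vertex, v.length = n → meanI P (S v) = c := fun v hv => by
    refine Subtype.ext ?_
    -- Evenness of `n` makes the leaf mean `a` rather than `b`.
    rw [coe_meanI P (hS.measurable_S v), hS.integral_eq, hv, if_pos hn]
  have hφmean : ∀ ω, ∫ ω', (φ (X ω, Y ω') : ℝ) ∂P
      = treeEval n (fun v => N v ω) (fun _ => c) [] := fun ω => by
    have h1 := (iIndepFun_treeEval hS.measurable_S (ex (X ω)) n 0
      (by rw [zero_add]; exact hS.indep_level n)).2 [] rfl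
    have h2 : ∀ ω', φ (X ω, Y ω') = treeEval n (ex (X ω)) (fun w => S w ω') [] := fun ω' => by
      refine treeEval_congr n [] (fun _ _ => rfl) fun v hv => ?_
      have hv' : v.length = n := by simpa using hv
      simp [hey, hYdef, hv']
    simp only [h2]
    rw [← coe_meanI P (measurable_treeEval n (ν := fun _ => ex (X ω)) (fun _ => measurable_const) hS.measurable_S []),
      h1]
    refine congrArg _ (treeEval_congr n [] (fun v hv => ?_) fun v hv => ?_)
    · have hv' : v.length < n := by simpa using hv
      simp [hex, hXdef, hv']
    · exact hcm v (by simpa using hv)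
  have hZ : ∀ ω, treeEval n (fun v => N v ω) (fun _ => c) []
      = treeEval n (ex (X ω)) (fun _ => c) [] := fun ω => by
    refine treeEval_congr n [] (fun v hv => ?_) fun v hv => rfl
    have hv' : v.length < n := by simpa using hv
    simp [hex, hXdef, hv']
  have hle := noiseAbove_le hS.measurable_N n
  have hZm : Measurable fun ω => treeEval n (fun v => N v ω) (fun _ => c) [] :=
    measurable_treeEval n hS.measurable_N (fun _ => measurable_const) []
  refine (ae_eq_condExp_of_forall_setIntegral_eq hle ?_ ?_ ?_ ?_).symm
  · exact (integrable_const _).indicator (hS.measurable_S [] (measurableSet_singleton 1))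
  · exact fun _ _ _ => (integrable_unitInterval P hZm).integrableOn
  · rintro _ ⟨s, hs, rfl⟩ _
    rw [← setIntegral_congr_ae (hX hs) (hφS.mono fun ω h _ => h)]
    rw [setIntegral_comp_eq_of_indepFun hX hY (hS.indep_noise n).symm hφ hs]
    simp only [hφmean]
    rfl
  · have h1 : Measurable[noiseAbove N n] fun ω => (treeEval n (ex (X ω)) (fun _ => c) [] : ℝ) := by
      have h2 : Measurable fun x => (treeEval n (ex x) (fun _ => c) [] : ℝ) :=
        (measurable_treeEval n hexm (fun _ => measurable_const) []).subtype_val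
      exact h2.comp (comap_measurable _)
    simp only [hZ]
    exact h1.stronglyMeasurable.aestronglyMeasurable

/-- The law of the conditional probability solution is the limit of the even iterates of the
recursion, started from the constant `a`. -/
theorem tendsto_condSolLaw (ha : a ∈ Set.Icc (0 : ℝ) 1) :
    Tendsto (fun n : ℕ => (rdeLaw d ∘ rdeLaw d)^[n] (diracLaw ⟨a, ha⟩)) atTop
      (𝓝 (condSolLaw P N hS.measurable_N S)) := by
  rw [ProbabilityMeasure.tendsto_iff_forall_integral_tendsto]
  intro f
  set g : Ω → ℝ := {ω | S [] ω = 1}.indicator fun _ => (1 : ℝ) with hg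
  set 𝓕 : Filtration ℕ ‹MeasurableSpace Ω› :=
    ⟨noiseAbove N, noiseAbove_mono N, noiseAbove_le hS.measurable_N⟩ with h𝓕
  set Z : ℕ → Ω → I := fun n ω => treeEval (2 * n) (fun v => N v ω) (fun _ => ⟨a, ha⟩) [] with hZ
  have hZm : ∀ n, Measurable (Z n) := fun n =>
    measurable_treeEval _ hS.measurable_N (fun _ => measurable_const) []
  -- Lévy's upward theorem, used below along even levels only.
  have hlev : ∀ᵐ ω ∂P, Tendsto (fun n => (P[g|noiseAbove N n]) ω) atTop (𝓝 ((P[g|noise N]) ω)) := by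
    have := tendsto_ae_condExp (μ := P) (ℱ := 𝓕) g
    have h2 : ⨆ n, 𝓕 n = noise N := iSup_noiseAbove N
    rw [h2] at this
    exact this
  have hae : ∀ᵐ ω ∂P, Tendsto (fun n => Z n ω) atTop (𝓝 (condSol P N S ω)) := by
    have h3 : ∀ᵐ ω ∂P, ∀ n : ℕ, (P[g|noiseAbove N (2 * n)]) ω = Z n ω :=
      ae_all_iff.2 fun n => hS.condExp_noiseAbove_ae_eq ha (even_two_mul n)
    filter_upwards [hlev, h3] with ω h1 h2
    have h4 := h1.comp (tendsto_id.const_mul_atTop' (show 0 < 2 by norm_num))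
    have h5 := (continuous_projIcc (a := (0 : ℝ)) (b := 1) (h := zero_le_one)).tendsto _ |>.comp h4
    refine h5.congr fun n => ?_
    simp only [Function.comp, id, h2]
    exact Set.projIcc_val _ _
  have hlaw : ∀ n, P.map (Z n)
      = ((rdeLaw d ∘ rdeLaw d)^[n] (diracLaw ⟨a, ha⟩) :
        ProbabilityMeasure I) := fun n => by
    have h1 : (rdeLaw d ∘ rdeLaw d)^[n] = (rdeLaw d)^[2 * n] := by
      rw [Function.iterate_mul]; rfl
    rw [h1, ← map_treeEval]
    have h2 : P.map (fun ω v => N v ω) = treeLaw d := by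
      rw [hS.indep_N.map_fun_eq_infinitePi_map hS.measurable_N]
      simp only [hS.law_N]
    rw [← h2, Measure.map_map (measurable_treeEval _ (fun v => measurable_pi_apply v)
      (fun _ => measurable_const) _) (measurable_pi_iff.2 hS.measurable_N)]
    rfl
  have hfm : Measurable f := f.continuous.measurable
  simp only [← hlaw]
  change Tendsto _ _ (𝓝 (∫ x, f x ∂(P.map (condSol P N S))))
  rw [integral_map (measurable_condSol hS.measurable_N S).aemeasurable hfm.aestronglyMeasurable]
  have h6 : ∀ n, ∫ x, f x ∂(P.map (Z n)) = ∫ ω, f (Z n ω) ∂P := fun n =>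
    integral_map (hZm n).aemeasurable hfm.aestronglyMeasurable
  simp only [h6]
  refine tendsto_integral_of_dominated_convergence (fun _ => ‖f‖)
    (fun n => (hfm.comp (hZm n)).aestronglyMeasurable) (integrable_const _)
    (fun n => Eventually.of_forall fun ω => f.norm_coe_le_norm _) ?_
  filter_upwards [hae] with ω hω
  exact (f.continuous.tendsto _).comp hω

end IsInterleavedDiscreteSolution

/-! ### Iterates of the recursion -/

/-- The mean of `X (1 - X)`. -/
def bernoulliGap (ν : ProbabilityMeasure I) : ℝ := mean ν - secondMoment ν

theorem bernoulliGap_nonneg (ν : ProbabilityMeasure I) : 0 ≤ bernoulliGap ν :=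
  sub_nonneg.2 (secondMoment_le_mean ν)

theorem bernoulliGap_le (ν : ProbabilityMeasure I) : bernoulliGap ν ≤ mean ν - mean ν ^ 2 :=
  sub_le_sub_left (sq_mean_le_secondMoment ν) _

/-- With second moment `q = m - v`, this is `(1 - H m) - (1 - 2 * H m + H q)`. -/
theorem bernoulliGap_rdeLaw (d : ProbabilityMeasure ℕ∞) (ν : ProbabilityMeasure I) :
    bernoulliGap (rdeLaw d ν) = gap (pgf d) (mean ν) (bernoulliGap ν) := by
  rw [bernoulliGap, mean_rdeLaw, secondMoment_rdeLaw, gap, momentMap, bernoulliGap, sub_sub_cancel]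
  ring

theorem bernoulliGap_eq_zero_iff (ν : ProbabilityMeasure I) :
    bernoulliGap ν = 0 ↔ (ν : Measure I) {0, 1} = 1 := by
  have hint : Integrable (fun x : I => (x : ℝ) * (1 - x)) (ν : Measure I) :=
    integrable_of_continuous ν (by fun_prop)
  rw [bernoulliGap, ← mean_sub_secondMoment, integral_eq_zero_iff_of_nonneg
    (fun x : I => mul_nonneg x.2.1 (sub_nonneg.2 x.2.2)) hint,
    ← mem_ae_iff_prob_eq_one (Set.toFinite _).measurableSet]
  have : {x : I | (fun x : I => (x : ℝ) * (1 - x)) x = (0 : I → ℝ) x} = {0, 1} := by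
    ext x
    simp only [Set.mem_ofPred_eq, Pi.zero_apply, mul_eq_zero, sub_eq_zero, Set.mem_insert_iff,
      Set.mem_singleton_iff, Subtype.ext_iff, Set.Icc.coe_zero, Set.Icc.coe_one]
    rw [eq_comm (a := (1 : ℝ))]
  rw [← this]
  rfl

theorem mean_diracLaw (c : I) : mean (diracLaw c) = c := by
  simp [mean, diracLaw]

theorem secondMoment_diracLaw (c : I) : secondMoment (diracLaw c) = c * c := by
  simp [secondMoment, diracLaw]

theorem mean_iterate (d : ProbabilityMeasure ℕ∞) (ν : ProbabilityMeasure I) (n : ℕ) :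
    mean ((rdeLaw d ∘ rdeLaw d)^[n] ν) = (momentMap d ∘ momentMap d)^[n] (mean ν) := by
  induction n with
  | zero => rfl
  | succ n ih =>
    rw [Function.iterate_succ_apply', Function.iterate_succ_apply', Function.comp_apply,
      mean_rdeLaw, mean_rdeLaw, ih]
    rfl

theorem iterate_fixed (d : ProbabilityMeasure ℕ∞) {a b : ℝ} (hab : momentMap d a = b)
    (hba : momentMap d b = a) (n : ℕ) : (momentMap d ∘ momentMap d)^[n] a = a :=
  Function.iterate_fixed (by simp [hab, hba]) n

theorem tendsto_bernoulliGap {ν : ℕ → ProbabilityMeasure I} {π : ProbabilityMeasure I}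
    (h : Tendsto ν atTop (𝓝 π)) :
    Tendsto (fun n => bernoulliGap (ν n)) atTop (𝓝 (bernoulliGap π)) :=
  (tendsto_mean h).sub (tendsto_secondMoment h)

theorem bernoulliGap_iterate_succ (d : ProbabilityMeasure ℕ∞) (π : ProbabilityMeasure I) (n : ℕ) :
    bernoulliGap ((rdeLaw d ∘ rdeLaw d)^[n + 1] π) =
      gap (pgf d) (momentMap d (mean ((rdeLaw d ∘ rdeLaw d)^[n] π)))
        (gap (pgf d) (mean ((rdeLaw d ∘ rdeLaw d)^[n] π))
          (bernoulliGap ((rdeLaw d ∘ rdeLaw d)^[n] π))) := by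
  rw [Function.iterate_succ_apply', Function.comp_apply, bernoulliGap_rdeLaw, bernoulliGap_rdeLaw,
    mean_rdeLaw]

/-- In the stable case every law whose mean is attracted to `a` becomes discrete. -/
theorem tendsto_bernoulliGap_zero {d : ProbabilityMeasure ℕ∞} (hH : IsGenFun (pgf d)) {a b : ℝ}
    (ha : a ∈ Set.Icc (0 : ℝ) 1) (hab : momentMap d a = b)
    (hcase : a = 0 ∨ a = 1 ∨ deriv (pgf d) a * deriv (pgf d) b ≤ 1) {π : ProbabilityMeasure I}
    (hπ : mean π ∈ momentBasin₂ d a) :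
    Tendsto (fun n => bernoulliGap ((rdeLaw d ∘ rdeLaw d)^[n] π)) atTop (𝓝 0) := by
  set ν : ℕ → ProbabilityMeasure I := fun n => (rdeLaw d ∘ rdeLaw d)^[n] π with hν
  have hm : Tendsto (fun n => mean (ν n)) atTop (𝓝 a) := by
    simpa only [hν, mean_iterate] using hπ.2
  by_cases hdeg : a = 0 ∨ a = 1
  · have h1 : Tendsto (fun n => mean (ν n) - mean (ν n) ^ 2) atTop (𝓝 (a - a ^ 2)) :=
      hm.sub (hm.pow 2)
    have h2 : a - a ^ 2 = 0 := by rcases hdeg with h | h <;> rw [h] <;> norm_num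
    rw [h2] at h1
    exact squeeze_zero (fun n => bernoulliGap_nonneg _) (fun n => bernoulliGap_le _) h1
  · rw [not_or] at hdeg
    have hderiv : deriv (pgf d) a * deriv (pgf d) b ≤ 1 := by tauto
    have ha' : a ∈ Set.Ioo (0 : ℝ) 1 :=
      ⟨ha.1.lt_of_ne (Ne.symm hdeg.1), ha.2.lt_of_ne hdeg.2⟩
    have hb : 1 - pgf d a = b := hab
    have hb' : b ∈ Set.Ioo (0 : ℝ) 1 := hb ▸ hH.one_sub_mem_Ioo ha'
    refine hH.tendsto_gap_zero ha' (hH.diff a ha').hasDerivAt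
      (B := deriv (pgf d) b) (by rw [hb]; exact (hH.diff b hb').hasDerivAt) hderiv
      (m := fun n => mean (ν n)) (u := fun n => bernoulliGap (rdeLaw d (ν n)))
      (fun n => mean_mem _) hm (fun n => bernoulliGap_nonneg _) (fun n => ?_)
      (fun n => bernoulliGap_rdeLaw d _) (fun n => ?_) (fun n => ?_)
    · exact sub_le_self _ (secondMoment_nonneg _)
    · refine (sub_le_self _ (secondMoment_nonneg _)).trans_eq ?_
      rw [mean_rdeLaw]; rfl
    · rw [bernoulliGap_rdeLaw]
      exact bernoulliGap_iterate_succ d π n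

/-- The graph of a constant as a coupling. -/
theorem exists_coupling_diracLaw (π : ProbabilityMeasure I) (c : I) :
    ∃ γ : ProbabilityMeasure (I × I), (γ : Measure (I × I)).map Prod.fst = π ∧
      (γ : Measure (I × I)).map Prod.snd = diracLaw c ∧ mixedMoment γ = mean π * c := by
  have hm : Measurable fun x : I => (x, c) := by fun_prop
  refine ⟨⟨(π : Measure I).map fun x => (x, c), Measure.isProbabilityMeasure_map hm.aemeasurable⟩,
    ?_, ?_, ?_⟩
  · rw [ProbabilityMeasure.coe_mk, Measure.map_map measurable_fst hm]
    exact Measure.map_id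
  · rw [ProbabilityMeasure.coe_mk, Measure.map_map measurable_snd hm]
    change Measure.map (fun _ => c) _ = _
    rw [Measure.map_const]
    simp [diracLaw]
  · change ∫ p : I × I, (p.1 : ℝ) * p.2 ∂((π : Measure I).map fun x => (x, c)) = _
    rw [integral_map hm.aemeasurable
      (by exact ((measurable_subtype_coe.comp measurable_fst).mul
        (measurable_subtype_coe.comp measurable_snd)).aestronglyMeasurable)]
    simp only [mean, integral_mul_const]

/-- A law and the constant with the same mean can be coupled along the recursion, so that their
mean square distance is the difference of the second moments. -/
theorem exists_coupling_iterate (d : ProbabilityMeasure ℕ∞) (π : ProbabilityMeasure I) {c : I}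
    (hc : mean π = c) (n : ℕ) :
    ∃ γ : ProbabilityMeasure (I × I), (γ : Measure (I × I)).map Prod.fst = (rdeLaw d)^[n] π ∧
      (γ : Measure (I × I)).map Prod.snd = (rdeLaw d)^[n] (diracLaw c) ∧
      mean ((rdeLaw d)^[n] π) = mean ((rdeLaw d)^[n] (diracLaw c)) ∧
      mixedMoment γ = secondMoment ((rdeLaw d)^[n] (diracLaw c)) := by
  induction n with
  | zero =>
    obtain ⟨γ, h1, h2, h3⟩ := exists_coupling_diracLaw π c
    exact ⟨γ, h1, h2, by simp [mean_diracLaw, hc], by simp [h3, secondMoment_diracLaw, hc]⟩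
  | succ n ih =>
    obtain ⟨γ, h1, h2, h3, h4⟩ := ih
    simp only [Function.iterate_succ_apply']
    refine ⟨coupledLaw d γ, map_fst_coupledLaw d γ _ h1, map_snd_coupledLaw d γ _ h2, ?_, ?_⟩
    · rw [mean_rdeLaw, mean_rdeLaw, h3]
    -- Since the means agree, the mixed moment and the constant's second moment obey the same
    -- recursion; both start at `c * c`.
    · rw [mixedMoment_coupledLaw d γ _ _ h1 h2, secondMoment_rdeLaw, h3, h4]
      ring

/-- If the linearization is expanding, then all laws with mean `a` that are not discrete are
attracted by the limit of the iterates of the constant `a`. -/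
theorem unstable_dichotomy {d : ProbabilityMeasure ℕ∞} (hH : IsGenFun (pgf d)) {a b : ℝ}
    (ha : a ∈ Set.Ioo (0 : ℝ) 1) (hab : momentMap d a = b) (hba : momentMap d b = a)
    (hderiv : 1 < deriv (pgf d) a * deriv (pgf d) b) {ς : ProbabilityMeasure I}
    (hς : Tendsto (fun n : ℕ =>
      (rdeLaw d ∘ rdeLaw d)^[n] (diracLaw ⟨a, ha.1.le, ha.2.le⟩)) atTop (𝓝 ς)) :
    0 < bernoulliGap ς ∧ ∀ π : ProbabilityMeasure I, mean π = a → 0 < bernoulliGap π →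
      Tendsto (fun n : ℕ => (rdeLaw d ∘ rdeLaw d)^[n] π) atTop (𝓝 ς) := by
  set c : I := ⟨a, ha.1.le, ha.2.le⟩ with hc
  set T := rdeLaw d ∘ rdeLaw d with hT
  have hb : 1 - pgf d a = b := hab
  have hb' : b ∈ Set.Ioo (0 : ℝ) 1 := hb ▸ hH.one_sub_mem_Ioo ha
  have hmean : ∀ π : ProbabilityMeasure I, mean π = a → ∀ n, mean (T^[n] π) = a :=
    fun π hπ n => by rw [mean_iterate, hπ, iterate_fixed d hab hba]
  have hrec : ∀ π : ProbabilityMeasure I, mean π = a → ∀ n, bernoulliGap (T^[n + 1] π)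
      = gap (pgf d) b (gap (pgf d) a (bernoulliGap (T^[n] π))) := fun π hπ n => by
    rw [bernoulliGap_iterate_succ, hmean π hπ, hab]
  have hle : ∀ π : ProbabilityMeasure I, mean π = a → ∀ n, bernoulliGap (T^[n] π) ≤ a - a ^ 2 :=
    fun π hπ n => by
      have := bernoulliGap_le (T^[n] π)
      rwa [hmean π hπ] at this
  have hδ : mean (diracLaw c) = a := mean_diracLaw c
  have hδ0 : bernoulliGap (diracLaw c) = a - a ^ 2 := by
    rw [bernoulliGap, hδ, secondMoment_diracLaw, hc]; ring
  have hpos : 0 < a - a ^ 2 := by nlinarith [ha.1, ha.2]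
  have hu : ∀ n, bernoulliGap (rdeLaw d (T^[n] (diracLaw c)))
      = gap (pgf d) a (bernoulliGap (T^[n] (diracLaw c))) := fun n => by
    rw [bernoulliGap_rdeLaw, hmean _ hδ]
  have hub : ∀ n, bernoulliGap (rdeLaw d (T^[n] (diracLaw c))) < b := fun n => by
    have := bernoulliGap_le (rdeLaw d (T^[n] (diracLaw c)))
    rw [mean_rdeLaw, hmean _ hδ, hab] at this
    nlinarith [hb'.1]
  obtain ⟨l, hl, hlim⟩ := hH.exists_tendsto_gap ha hb' (hH.diff a ha).hasDerivAt
    (hH.diff b hb').hasDerivAt hderiv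
    (w := fun n => bernoulliGap (T^[n] (diracLaw c)))
    (wu := fun n => bernoulliGap (rdeLaw d (T^[n] (diracLaw c))))
    (fun n => (hle _ hδ n).trans_lt (by nlinarith [ha.1]))
    (fun n => (hle _ hδ n).trans_eq hδ0.symm) (hpos.trans_eq hδ0.symm) hu hub
    (fun n => by rw [hu, hrec _ hδ])
  have hw := hlim _ (hpos.trans_eq hδ0.symm) (fun _ => le_rfl) (hrec _ hδ)
  refine ⟨(tendsto_nhds_unique (tendsto_bernoulliGap hς) hw) ▸ hl, fun π hπ hπ0 => ?_⟩
  -- Among laws of mean `a` the constant has the largest gap, and the gap map is monotone.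
  have hcomp : ∀ n, bernoulliGap (T^[n] π) ≤ bernoulliGap (T^[n] (diracLaw c)) := fun n => by
    induction n with
    | zero => exact (hle π hπ 0).trans_eq hδ0.symm
    | succ n ih =>
      have h1 : bernoulliGap (T^[n] (diracLaw c)) ≤ a :=
        (hle _ hδ n).trans (by nlinarith [ha.1])
      have h2 : 0 ≤ gap (pgf d) a (bernoulliGap (T^[n] π)) := by
        have := bernoulliGap_nonneg (rdeLaw d (T^[n] π))
        rwa [bernoulliGap_rdeLaw, hmean π hπ] at this
      rw [hrec π hπ, hrec _ hδ]
      exact hH.gap_mono hb'.2.le h2 (hH.gap_mono ha.2.le (bernoulliGap_nonneg _) ih h1)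
        (hu n ▸ (hub n).le)
  have hv := hlim _ hπ0 hcomp (hrec π hπ)
  have hT2 : ∀ n, T^[n] = (rdeLaw d)^[2 * n] := fun n => by
    rw [Function.iterate_mul]; rfl
  choose γ h1 h2 h3 h4 using fun n => exists_coupling_iterate d π (c := c) hπ (2 * n)
  simp only [← hT2] at h1 h2 h3 h4
  refine tendsto_of_coupling h1 h2 ?_ hς
  have hdiff := hw.sub hv
  rw [sub_self] at hdiff
  refine hdiff.congr fun n => ?_
  rw [integral_sq_sub (γ n) _ _ (h1 n) (h2 n), h4, bernoulliGap, bernoulliGap, h3]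
  ring

/-- If the linearization is expanding, then `a` attracts no mean but itself. -/
theorem eq_of_mem_momentBasin₂ {d : ProbabilityMeasure ℕ∞} (hH : IsGenFun (pgf d)) {a b : ℝ}
    (ha : a ∈ Set.Ioo (0 : ℝ) 1) (hab : momentMap d a = b) (hba : momentMap d b = a)
    (hderiv : 1 < deriv (pgf d) a * deriv (pgf d) b) {m : ℝ} (hm : m ∈ momentBasin₂ d a) :
    m = a := by
  have hb : 1 - pgf d a = b := hab
  have hb' : b ∈ Set.Ioo (0 : ℝ) 1 := hb ▸ hH.one_sub_mem_Ioo ha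
  have hf : ∀ s ∈ Set.Ioo (0 : ℝ) 1, HasDerivAt (momentMap d) (-deriv (pgf d) s) s :=
    fun s hs => (hH.diff s hs).hasDerivAt.const_sub 1
  have hF : HasDerivAt (momentMap d ∘ momentMap d)
      (-deriv (pgf d) b * -deriv (pgf d) a) a := by
    refine HasDerivAt.comp a ?_ (hf a ha)
    rw [hab]
    exact hf b hb'
  obtain ⟨n, hn⟩ := exists_eq_of_tendsto_of_one_lt_deriv hF (by linarith)
    (by simp [hab, hba]) (x := fun n => (momentMap d ∘ momentMap d)^[n] m)
    (fun n => Function.iterate_succ_apply' _ _ _) hm.2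
  have hmaps : Set.MapsTo (momentMap d) (Set.Icc 0 1) (Set.Icc 0 1) :=
    fun x hx => hH.one_sub_mem hx
  have hinj : Set.InjOn (momentMap d) (Set.Icc 0 1) := fun x hx y hy hxy =>
    hH.strictMonoOn.injOn hx hy (sub_right_injective hxy)
  -- An orbit that hits the fixed point `a` started there, by injectivity on `[0,1]`.
  refine (hinj.comp hinj hmaps).iterate (hmaps.comp hmaps) n hm.1 ⟨ha.1.le, ha.2.le⟩ ?_
  rw [iterate_fixed d hab hba]
  exact hn

/-- A limit of iterates attracts only laws whose mean is attracted by its mean. -/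
theorem mean_mem_momentBasin₂ {d : ProbabilityMeasure ℕ∞} {π ς : ProbabilityMeasure I}
    (h : π ∈ lawBasin₂ d ς) : mean π ∈ momentBasin₂ d (mean ς) := by
  refine ⟨mean_mem π, ?_⟩
  simpa only [mean_iterate] using tendsto_mean h

theorem lawBasin₂_dichotomy {d : ProbabilityMeasure ℕ∞} (hH : IsGenFun (pgf d)) {a b : ℝ}
    (ha : a ∈ Set.Icc (0 : ℝ) 1) (hab : momentMap d a = b) (hba : momentMap d b = a)
    {ς : ProbabilityMeasure I}
    (hς : Tendsto (fun n : ℕ => (rdeLaw d ∘ rdeLaw d)^[n] (diracLaw ⟨a, ha⟩)) atTop (𝓝 ς)) :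
    (0 < a → a < 1 → 1 < deriv (pgf d) a * deriv (pgf d) b →
      lawBasin₂ d ς = {π | mean π = a ∧ (π : Measure I) {0, 1} ≠ 1}) ∧
    (a = 0 ∨ a = 1 ∨ deriv (pgf d) a * deriv (pgf d) b ≤ 1 →
      lawBasin₂ d ς = {π | mean π ∈ momentBasin₂ d a}) := by
  have hmς : mean ς = a := by
    refine tendsto_nhds_unique (tendsto_mean hς) (tendsto_const_nhds.congr fun n => ?_)
    rw [mean_iterate, mean_diracLaw, iterate_fixed d hab hba]
  constructor
  · intro h0 h1 hderiv
    have ha' : a ∈ Set.Ioo (0 : ℝ) 1 := ⟨h0, h1⟩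
    obtain ⟨hpos, hlim⟩ := unstable_dichotomy hH ha' hab hba hderiv hς
    ext π
    simp only [Set.mem_ofPred_eq, Ne, ← bernoulliGap_eq_zero_iff]
    constructor
    · intro hπ
      have hmπ : mean π = a :=
        eq_of_mem_momentBasin₂ hH ha' hab hba hderiv (hmς ▸ mean_mem_momentBasin₂ hπ)
      refine ⟨hmπ, fun h => hpos.ne' ?_⟩
      refine tendsto_nhds_unique (tendsto_bernoulliGap hπ) (tendsto_const_nhds.congr fun n => ?_)
      induction n with
      | zero => exact h.symm
      | succ n ih => rw [bernoulliGap_iterate_succ, ← ih]; simp [gap]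
    · rintro ⟨hmπ, h⟩
      exact hlim π hmπ ((bernoulliGap_nonneg π).lt_of_ne (Ne.symm h))
  · intro hcase
    have hint : ∀ π : ProbabilityMeasure I, mean π ∈ momentBasin₂ d a → ∀ f : C(I, ℝ),
        Tendsto (fun n => ∫ x, f x ∂((rdeLaw d ∘ rdeLaw d)^[n] π : Measure I)) atTop
          (𝓝 ((1 - a) * f 0 + a * f 1)) := fun π hπ f =>
      tendsto_integral_of_tendsto_mean (by simpa only [mean_iterate] using hπ.2)
        (tendsto_bernoulliGap_zero hH ha hab hcase hπ) f
    have hself : mean (diracLaw ⟨a, ha⟩) ∈ momentBasin₂ d a := by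
      rw [mean_diracLaw]
      exact ⟨ha, tendsto_const_nhds.congr fun n => (iterate_fixed d hab hba n).symm⟩
    ext π
    constructor
    · exact fun hπ => hmς ▸ mean_mem_momentBasin₂ hπ
    · intro hπ
      refine ProbabilityMeasure.tendsto_iff_forall_integral_tendsto.2 fun f => ?_
      have h1 := ProbabilityMeasure.tendsto_iff_forall_integral_tendsto.1 hς f
      -- The constant `a` lies in the attracted class itself, which identifies `ς` with the law on
      -- `{0,1}` of mean `a`.
      have h2 := tendsto_nhds_unique h1 (hint _ hself f.toContinuousMap)
      rw [h2]
      exact hint π hπ f.toContinuousMap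

end

end VetoVoter

theorem theorem6p3
    -- the law of the family size `N`, with `H 0 = 0` and `H` strictly convex
    (d : MeasureTheory.ProbabilityMeasure ℕ∞)
    (hH0 : VetoVoter.pgf d 0 = 0)
    (hHconv : StrictConvexOn ℝ (Set.Icc (0 : ℝ) 1) (VetoVoter.pgf d))
    -- a fixed point `a = μ¹₊` of `f ∘ f` in `[0,1]`, with partner `b = μ¹₋ = f a`
    (a b : ℝ) (ha : a ∈ Set.Icc (0 : ℝ) 1)
    (hab : VetoVoter.momentMap d a = b) (hba : VetoVoter.momentMap d b = a)
    -- the corresponding discrete solution on the tree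
    {Ω : Type*} [MeasurableSpace Ω] (P : MeasureTheory.Measure Ω)
    [MeasureTheory.IsProbabilityMeasure P]
    (N : VetoVoter.Vertex → Ω → ℕ∞) (S : VetoVoter.Vertex → Ω → unitInterval)
    (hS : VetoVoter.IsInterleavedDiscreteSolution P d a b N S) :
    (0 < a → a < 1 → 1 < deriv (VetoVoter.pgf d) a * deriv (VetoVoter.pgf d) b →
      VetoVoter.lawBasin₂ d (VetoVoter.condSolLaw P N hS.measurable_N S) =
        {π | VetoVoter.mean π = a ∧ (π : MeasureTheory.Measure unitInterval) {0, 1} ≠ 1}) ∧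
    (a = 0 ∨ a = 1 ∨ deriv (VetoVoter.pgf d) a * deriv (VetoVoter.pgf d) b ≤ 1 →
      VetoVoter.lawBasin₂ d (VetoVoter.condSolLaw P N hS.measurable_N S) =
        {π | VetoVoter.mean π ∈ VetoVoter.momentBasin₂ d a}) := by
  exact VetoVoter.lawBasin₂_dichotomy (VetoVoter.isGenFun_pgf d hH0 hHconv) ha hab hba
    (hS.tendsto_condSolLaw ha)
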